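/- **Lemma (Main structural lemma).** *Definitions.* For $r\ge 1$, an $r$-coloured graph $G$ is a finite simple graph with a colour from $\{1,\dots,r\}$ on each edge; $G_i$ is the spanning subgraph on $V(G)$ of the edges of colour $i$. For $r=2$, colour 1 is red and colour 2 is blue. The empty set, a single vertex and an edge count as cycles on $0,1,2$ vertices, and $G$ *has a partition into a red cycle and a blue cycle* if $V(G)$ is the disjoint union of the vertex sets of a cycle in $G_1$ and a cycle in $G_2$. Write $|H|=|V(H)|$, let $e_H(A,B)$ be the number of edges of $H$ with one endpoint in $A$ and the other in $B$, let $e_H(A)=e_H(A,A)$, and let $\deg_i(v,A)$ be the number of neighbours of $v$ in $A$ in the graph $G_i$. * Let $F$ be a graph on $n$ vertices. A subgraph $H\subseteq F$ is *$(\eta,\alpha)$-robust* if every vertex of $H$ has at least $\eta n$ neighbours in $H$, and $e_H(X,V(H)\setminus X)\ge\alpha|X||V(H)\setminus X|$ for every $X\subseteq V(H)$. * $H$ is *$\beta$-near-bipartite* if there is $X\subseteq V(H)$ with $e_H(X)<\beta|H|^2$ and $e_H(V(H)\setminus X)<\beta|H|^2$. An *$(\eta,\beta)$-bipartition* of $H$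 is a partition $\{X,Y\}$ of $V(H)$ with $e_H(X),e_H(Y)<\beta|H|^2$ such that every vertex of $X$ has at least $\eta|H|$ neighbours (in $H$) in $Y$ and every vertex of $Y$ has at least $\eta|H|$ neighbours (in $H$) in $X$. $H[X,Y]$ is the subgraph of $H$ on $X\cup Y$ consisting of the edges of $H$ between $X$ and $Y$. * Let $G$ be an $r$-coloured graph on $n$ vertices. For $i\in[r]$ let $\mathcal H_i$ be a (possibly empty) set of vertex-disjoint $(\eta,\alpha)$-robust subgraphs of $G_i$. Then $\mathcal H=\bigcup_{i}\mathcal H_i$ is an *$(\eta,\alpha)$-nice partition* of $G$ if the members of $\mathcal H$ cover $V(G)$ and, whenever $H\in\mathcal H_i$ is $\alpha^4$-near-bipartite, there are an $(\eta/2,\alpha^2)$-bipartition $\{X,Y\}$ of $H$ with $|X|\le|Y|$ such that $H[X,Y]$ is an $(\eta/2,\alpha/2)$-robust subgraph of $G_i$, and some $H'\in\mathcal H_j$ with $j\ne i$ that is not $\alpha^4$-near-bipartite and satisfies $|V(H')\cap Y|\ge\eta^{1/2}n$. *Statement.* There are functions $\eta_0,\alpha_0:(0,\infty)\to(0,\infty)$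 and $n_0:(0,\infty)\to\mathbb N$ such that the following holds whenever $0<\gamma\le 1/4$, $0<\eta\le\eta_0(\gamma)$, $0<\alpha\le\alpha_0(\eta)$ and $n\ge n_0(\alpha)$. Let $G$ be a $2$-coloured graph on $n$ vertices with $\delta(G)\ge(3/4+\gamma)n$. Then either $G$ has a partition into a red cycle and a blue cycle, or 1. for some $i\in\{1,2\}$ there is an $(\eta,\alpha)$-robust subgraph $H_i\subseteq G_i$ with $|H_i|\ge(1-\eta^{2/3})n$ that is not $\alpha^4$-near-bipartite, and $\deg_i(v,V(H_i))<\eta n$ for all $v\in V(G)\setminus V(H_i)$; or 2. there are $(\eta,\alpha)$-robust subgraphs $H_1\subseteq G_1$ and $H_2\subseteq G_2$ such that $\{H_1,H_2\}$ (with $\mathcal H_i=\{H_i\}$) is an $(\eta,\alpha)$-nice partition of $G$, such that $\deg_i(v,V(H_i))<\eta n$ for both $i\in\{1,2\}$ and all $v\in V(G)\setminus V(H_i)$, and such that (a) $|H_1|,|H_2|\ge(3/4+\gamma/2)n$, or (b) for some $i\in\{1,2\}$, $|H_i|\ge(1-\eta^{2/3})n$, $H_i$ is $\alpha^4$-near-bipartite,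 and $|H_{3-i}|\ge(1/2+\eta^2)n$. -/

import Mathlib

universe u

namespace RobustStructure

variable {V : Type*} {G : SimpleGraph V}

/-- The number of edges of `H` with one endpoint in `A` and the other endpoint in `B`;
`edgeCount H A A` is the number of edges inside `A`. -/
noncomputable def edgeCount (H : G.Subgraph) (A B : Set V) : ℕ :=
  {e ∈ H.edgeSet | ∃ a ∈ A, ∃ b ∈ B, e = s(a, b)}.ncard

/-- The number of neighbours that `v` has in the set `A` along edges of `H`. -/
noncomputable def degIn (H : G.Subgraph) (v : V) (A : Set V) : ℕ :=
  (H.neighborSet v ∩ A).ncard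

/-- The number of neighbours in the graph `G` that `v` has in the set `A`. -/
noncomputable def graphDegIn (G : SimpleGraph V) (v : V) (A : Set V) : ℕ :=
  (G.neighborSet v ∩ A).ncard

/-- Some `X ⊆ V(H)` has fewer than `α |X| |V(H) ∖ X|` edges of `H` leaving it. -/
def HasSparseCut (α : ℝ) (H : G.Subgraph) : Prop :=
  ∃ X ⊆ H.verts, (edgeCount H X (H.verts \ X) : ℝ) < α * X.ncard * (H.verts \ X).ncard

/-- A subgraph `H` of a graph on `n = |V|` vertices is `(η, α)`-robust: its minimum degree is at
least `η n`, with `n` the number of vertices of the ambient graph, and it has no `α`-sparse cut. -/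
def IsRobust [Fintype V] (η α : ℝ) (H : G.Subgraph) : Prop :=
  (∀ v ∈ H.verts, η * Fintype.card V ≤ (H.neighborSet v).ncard) ∧ ¬ HasSparseCut α H

/-- `H` is `β`-near-bipartite, relative to its own number of vertices. -/
def IsNearBipartite (β : ℝ) (H : G.Subgraph) : Prop :=
  ∃ X ⊆ H.verts,
    (edgeCount H X X : ℝ) < β * (H.verts.ncard : ℝ) ^ 2 ∧
    (edgeCount H (H.verts \ X) (H.verts \ X) : ℝ) < β * (H.verts.ncard : ℝ) ^ 2

/-- `{X, Y}` is an `(η, β)`-bipartition of `H`: a partition of `V(H)` that witnesses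
`β`-near-bipartiteness and has minimum degree at least `η |V(H)|` from each side to the other. -/
def IsBipartition (η β : ℝ) (H : G.Subgraph) (X Y : Set V) : Prop :=
  X ∪ Y = H.verts ∧ Disjoint X Y ∧
  (edgeCount H X X : ℝ) < β * (H.verts.ncard : ℝ) ^ 2 ∧
  (edgeCount H Y Y : ℝ) < β * (H.verts.ncard : ℝ) ^ 2 ∧
  (∀ x ∈ X, η * H.verts.ncard ≤ degIn H x Y) ∧
  (∀ y ∈ Y, η * H.verts.ncard ≤ degIn H y X)

/-- The bipartite subgraph `H[X, Y]`: all edges of `H` with one endpoint in `X` and the other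
in `Y`. -/
def betweenSubgraph (H : G.Subgraph) (X Y : Set V) : G.Subgraph where
  verts := H.verts ∩ (X ∪ Y)
  Adj u v := H.Adj u v ∧ ((u ∈ X ∧ v ∈ Y) ∨ (u ∈ Y ∧ v ∈ X))
  adj_sub h := H.adj_sub h.1
  edge_vert := by
    rintro u v ⟨h, h' | h'⟩
    · exact ⟨H.edge_vert h, Or.inl h'.1⟩
    · exact ⟨H.edge_vert h, Or.inr h'.1⟩
  symm := ⟨by
    rintro u v ⟨h, h' | h'⟩
    · exact ⟨h.symm, Or.inr ⟨h'.2, h'.1⟩⟩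
    · exact ⟨h.symm, Or.inl ⟨h'.2, h'.1⟩⟩⟩

/-- In an `r`-coloured graph `G` with colour classes `C.labelGraph i`, the families `ℋ i` of
subgraphs of the `i`-th colour class form an `(η, α)`-nice partition of `G`. -/
def IsNicePartition [Fintype V] {r : ℕ} (η α : ℝ) (C : G.EdgeLabeling (Fin r))
    (ℋ : ∀ i : Fin r, Set (C.labelGraph i).Subgraph) : Prop :=
  (∀ i, (ℋ i).Pairwise fun H H' => Disjoint H.verts H'.verts) ∧
  (∀ i, ∀ H ∈ ℋ i, IsRobust η α H) ∧
  (∀ v : V, ∃ i, ∃ H ∈ ℋ i, v ∈ H.verts) ∧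
  (∀ i, ∀ H ∈ ℋ i, IsNearBipartite (α ^ 4) H →
    ∃ X Y : Set V, IsBipartition (η / 2) (α ^ 2) H X Y ∧ X.ncard ≤ Y.ncard ∧
      IsRobust (η / 2) (α / 2) (betweenSubgraph H X Y) ∧
      ∃ j, j ≠ i ∧ ∃ H' ∈ ℋ j, ¬ IsNearBipartite (α ^ 4) H' ∧
        η ^ (1 / 2 : ℝ) * Fintype.card V ≤ (H'.verts ∩ Y).ncard)

/-- `S` is the vertex set of a cycle in `G`, where the empty set, a single vertex and an edge
count as cycles on `0`, `1` and `2` vertices. -/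
def IsCycleSet (G : SimpleGraph V) (S : Set V) : Prop :=
  S = ∅ ∨ (∃ v, S = {v}) ∨ (∃ u v, G.Adj u v ∧ S = {u, v}) ∨
    ∃ (v : V) (p : G.Walk v v), p.IsCycle ∧ S = {w | w ∈ p.support}

/-- The `2`-coloured graph `G` has a partition into a cycle of colour `0` (red) and a cycle of
colour `1` (blue). -/
def HasCyclePartition (C : G.EdgeLabeling (Fin 2)) : Prop :=
  ∃ S : Set V, IsCycleSet (C.labelGraph 0) S ∧ IsCycleSet (C.labelGraph 1) Sᶜ

end RobustStructure

namespace RobustStructure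

open Finset

/-! Put `q = η ^ (1/3)`, so that `η ^ (2/3) = q ^ 2`. The minimum degree enters only through
`MissAtMost`: a vertex fails to see, in either colour, at most `(1/4 - γ) n` vertices of any set.

Dichotomy (`exists_hull_dichotomy`): for an ordered pair of colours, take a maximal set `A` of size
at most about `n/2` whose vertices send few edges of the first colour out of `A`. If `A` is small,
its complement has no sparse cut in that colour and grows to an almost spanning robust subgraph. If
`A` is not small, nearly all edges between `A` and its complement have the second colour, and these
give a robust subgraph in the second colour on at least `(3/4 + γ/2) n` vertices. In both cases
`exists_robust_closure` adds vertices of large degree until none is left outside.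

If no colour has an almost spanning hull, the dichotomy used both ways gives two hulls of size `(3/4
+ γ/2) n`, which is outcome 2(a); `hasNiceBipartition_of_large_hulls` supplies the niceness. If an
almost spanning hull is not near-bipartite, outcome 1 holds. Otherwise its larger class is dense in
the other colour, and that class grows to a hull `T` there. If `T` has noticeably more than `n/2`
vertices, outcome 2(b) holds.

In the remaining case the graph is close to extremal: two nearly equal halves, the first colour rare
inside both and the second colour rare between them. Then a cycle partition exists
(`cyclePartition_of_sparse_pair`): a short cycle of the second colour absorbs the atypical vertices
and equalises the halves, and the rest is Hamiltonian in the first colour by a bipartite closure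
argument (`hasCyclicOrder_of_degrees`). -/

/-- A closed chain of distinct adjacent vertices with at least three entries spans a cycle. -/
theorem isCycleSet_of_list {V : Type*} {G : SimpleGraph V} (l : List V) (hlen : 3 ≤ l.length)
    (hnd : l.Nodup) (hch : l.IsChain G.Adj)
    (hcl : ∀ x ∈ l.getLast?, ∀ y ∈ l.head?, G.Adj x y) : IsCycleSet G {w | w ∈ l} := by
  have key : ∀ (l : List V) (a : V), (a :: l).IsChain G.Adj →
      ∃ (b : V) (p : G.Walk a b), p.support = a :: l ∧ (a :: l).getLast? = some b := by
    intro l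
    induction l with
    | nil => intro a _; exact ⟨a, .nil, by simp⟩
    | cons c l ih =>
      intro a h
      rw [List.isChain_cons_cons] at h
      obtain ⟨b, p, hp, hb⟩ := ih c h.2
      exact ⟨b, .cons h.1 p, by simp [hp], by simpa [List.getLast?_cons_cons] using hb⟩
  obtain _ | ⟨a, l⟩ := l
  · simp at hlen
  obtain ⟨b, p, hp, hb⟩ := key l a hch
  have hadj : G.Adj b a := hcl b hb a rfl
  refine Or.inr (Or.inr (Or.inr ⟨b, .cons hadj p, ?_, ?_⟩))
  · rw [SimpleGraph.Walk.isCycle_iff_isPath_tail_and_le_length]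
    refine ⟨?_, ?_⟩
    · rw [SimpleGraph.Walk.isPath_def, SimpleGraph.Walk.support_tail_of_not_nil _ (by simp),
        SimpleGraph.Walk.support_cons, List.tail_cons, hp]
      exact hnd
    · have := p.length_support
      rw [hp] at this
      simp at this hlen ⊢
      omega
  · ext w
    have hbm : b ∈ a :: l := List.mem_of_getLast? hb
    simp only [SimpleGraph.Walk.support_cons, hp, Set.mem_ofPred_eq]
    constructor
    · intro h; exact List.mem_cons_of_mem _ h
    · intro h
      rcases List.mem_cons.1 h with rfl | h
      · exact hbm
      · exact h

/-! ### Hamiltonicity of balanced bipartite graphs by degree closure. -/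

section Hamilton

variable {V : Type*} [DecidableEq V]

/-- The graph `Γ` has a cyclic ordering of `S` in which consecutive vertices are adjacent. -/
def HasCyclicOrder (Γ : SimpleGraph V) (S : Finset V) : Prop :=
  ∃ l : List V, l.Nodup ∧ l.toFinset = S ∧ l.IsChain Γ.Adj ∧
    ∀ x ∈ l.getLast?, ∀ y ∈ l.head?, Γ.Adj x y

theorem HasCyclicOrder.isCycleSet {Γ : SimpleGraph V} {S : Finset V} (h : HasCyclicOrder Γ S)
    (hS : 3 ≤ #S) : IsCycleSet Γ (S : Set V) := by
  obtain ⟨l, hnd, rfl, hch, hcl⟩ := h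
  rw [List.toFinset_card_of_nodup hnd] at hS
  convert isCycleSet_of_list l hS hnd hch hcl using 1
  ext; simp

/-- Every edge of `Γ` has one endpoint in `A` and the other in `B`. -/
def IsBetween (Γ : SimpleGraph V) (A B : Finset V) : Prop :=
  ∀ u v, Γ.Adj u v → (u ∈ A ∧ v ∈ B) ∨ (u ∈ B ∧ v ∈ A)

-- The crossing argument: the predecessors on the path of the neighbours of `a` lie in `A`, so by
-- the degree sum one of them, `l[i]`, is a neighbour of `b`. Going from `a` to `l[i]`, jumping to
-- `b`, and returning along the path to `l[i + 1]` closes a cycle.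
open Classical in
theorem hasCyclicOrder_of_path {Γ : SimpleGraph V} {A B : Finset V} (hdis : Disjoint A B)
    (hb : IsBetween Γ A B) {a b : V} (ha : a ∈ A) (hbB : b ∈ B) (l : List V) (hnd : l.Nodup)
    (hl : l.toFinset = A ∪ B) (hch : l.IsChain Γ.Adj) (hhead : l.head? = some a)
    (hlast : l.getLast? = some b)
    (hdeg : #A + 1 ≤ #{y ∈ B | Γ.Adj a y} + #{x ∈ A | Γ.Adj b x}) :
    HasCyclicOrder Γ (A ∪ B) := by
  rw [List.isChain_iff_getElem] at hch
  have hdis' : ∀ x, x ∈ A → x ∈ B → False := fun x h1 h2 => Finset.disjoint_left.1 hdis h1 h2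
  have h0 : ∃ h : 0 < l.length, l[0] = a := by
    obtain _ | ⟨c, l⟩ := l
    · simp at hhead
    · simpa using hhead
  obtain ⟨hpos, h0⟩ := h0
  have hex : ∀ y ∈ ({y ∈ B | Γ.Adj a y} : Finset V),
      ∃ i, ∃ h : i + 1 < l.length, l[i + 1] = y := by
    intro y hy
    have hy' := (Finset.mem_filter.1 hy)
    have : y ∈ l := by
      rw [← List.mem_toFinset, hl]; exact Finset.mem_union_right _ hy'.1
    obtain ⟨i, hi, rfl⟩ := List.getElem_of_mem this
    obtain _ | i := i
    · exact (hdis' a ha (h0 ▸ hy'.1)).elim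
    · exact ⟨i, hi, rfl⟩
  choose! f hf hfy using hex
  let pr : V → V := fun y => if h : f y < l.length then l[f y] else a
  have hpr : ∀ y ∈ ({y ∈ B | Γ.Adj a y} : Finset V), ∃ h : f y < l.length, pr y = l[f y] := by
    intro y hy
    have : f y < l.length := by have := hf y hy; omega
    exact ⟨this, by simp [pr, this]⟩
  have hinj : Set.InjOn pr ({y ∈ B | Γ.Adj a y} : Finset V) := by
    intro y hy z hz hyz
    obtain ⟨h1, h1'⟩ := hpr y hy
    obtain ⟨h2, h2'⟩ := hpr z hz
    rw [h1', h2', hnd.getElem_inj_iff] at hyz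
    rw [← hfy y hy, ← hfy z hz]
    simp [hyz]
  have hsub : ({y ∈ B | Γ.Adj a y} : Finset V).image pr ⊆ A := by
    intro x hx
    obtain ⟨y, hy, rfl⟩ := Finset.mem_image.1 hx
    obtain ⟨h1, h1'⟩ := hpr y hy
    have := hch (f y) (hf y hy)
    rw [hfy y hy, ← h1'] at this
    rcases hb _ _ this with h | h
    · exact h.1
    · exact (hdis' y h.2 (Finset.mem_filter.1 hy).1).elim
  have hcross : ¬ Disjoint (({y ∈ B | Γ.Adj a y} : Finset V).image pr) {x ∈ A | Γ.Adj b x} := by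
    intro hd
    have h1 := Finset.card_union_of_disjoint hd
    have h2 := Finset.card_le_card
      (Finset.union_subset hsub (Finset.filter_subset (fun x => Γ.Adj b x) A))
    rw [Finset.card_image_of_injOn hinj] at h1
    omega
  obtain ⟨x, hx1, hx2⟩ := Finset.not_disjoint_iff.1 hcross
  obtain ⟨y, hy, rfl⟩ := Finset.mem_image.1 hx1
  obtain ⟨h1, h1'⟩ := hpr y hy
  have hbx : Γ.Adj b l[f y] := h1' ▸ (Finset.mem_filter.1 hx2).2
  have hay : Γ.Adj a (l[f y + 1]'(hf y hy)) := by rw [hfy y hy]; exact (Finset.mem_filter.1 hy).2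
  set i := f y
  have hi : i + 1 < l.length := hf y hy
  have hperm : (l.take (i + 1) ++ (l.drop (i + 1)).reverse).Perm l := by
    conv_rhs => rw [← List.take_append_drop (i + 1) l]
    exact List.Perm.append_left _ (List.reverse_perm _)
  refine ⟨l.take (i + 1) ++ (l.drop (i + 1)).reverse, hperm.nodup_iff.2 hnd, ?_, ?_, ?_⟩
  · rw [← hl]; exact List.toFinset_eq_of_perm _ _ hperm
  · have hch' : l.IsChain Γ.Adj := List.isChain_iff_getElem.2 hch
    rw [List.isChain_append]
    refine ⟨hch'.take _, ?_, ?_⟩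
    · rw [List.isChain_reverse]
      exact (hch'.drop _).imp fun _ _ h => h.symm
    · intro x hx y hy
      have hne : l.drop (i + 1) ≠ [] := by simp; omega
      have : x = l[i] := by
        rw [List.getLast?_take] at hx
        simp at hx
        rw [List.getElem?_eq_getElem (by omega)] at hx
        rcases hx with h | h
        · simpa using h.symm
        · omega
      subst this
      have : y = b := by
        rw [List.head?_reverse, List.getLast?_drop] at hy
        simp [hlast, show ¬ l.length ≤ i + 1 by omega] at hy
        exact hy.symm
      subst this
      exact hbx.symm
  · intro x hx y hy
    have : y = a := by
      rw [List.head?_append, List.head?_take] at hy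
      simp [hhead] at hy
      exact hy.symm
    subst this
    have : x = l[i + 1] := by
      rw [List.getLast?_append, List.getLast?_reverse, List.head?_drop,
        List.getElem?_eq_getElem hi] at hx
      simpa using hx.symm
    subst this
    exact hay.symm

/-- A cyclic order that exists only thanks to the new edge must use that edge. Rotating it into the
closing position and cutting there leaves a path in `Γ`. -/
theorem exists_path_of_cyclicOrder_sup_edge {Γ : SimpleGraph V} {S : Finset V} {a b : V}
    (hS : 3 ≤ #S) (hc : HasCyclicOrder (Γ ⊔ SimpleGraph.edge a b) S) (hn : ¬ HasCyclicOrder Γ S) :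
    ∃ l : List V, l.Nodup ∧ l.toFinset = S ∧ l.IsChain Γ.Adj ∧ l.head? = some a ∧
      l.getLast? = some b := by
  obtain ⟨l, hnd, hl, hch, hcl⟩ := hc
  have hlen : 3 ≤ l.length := by rwa [← List.toFinset_card_of_nodup hnd, hl]
  have hadj : ∀ x y, (Γ ⊔ SimpleGraph.edge a b).Adj x y → ¬ Γ.Adj x y →
      (x = a ∧ y = b) ∨ (x = b ∧ y = a) := by
    intro x y h h'
    rw [SimpleGraph.sup_adj, SimpleGraph.edge_adj] at h
    grind
  have rot : ∃ l' : List V, ∃ x y, l'.Nodup ∧ l'.toFinset = S ∧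
      l'.IsChain (Γ ⊔ SimpleGraph.edge a b).Adj ∧ l'.head? = some y ∧ l'.getLast? = some x ∧
      (Γ ⊔ SimpleGraph.edge a b).Adj x y ∧ ¬ Γ.Adj x y := by
    by_cases hΓ : l.IsChain Γ.Adj
    · have : ¬ ∀ x ∈ l.getLast?, ∀ y ∈ l.head?, Γ.Adj x y := fun h => hn ⟨l, hnd, hl, hΓ, h⟩
      push Not at this
      obtain ⟨x, hx, y, hy, hxy⟩ := this
      exact ⟨l, x, y, hnd, hl, hch, hy, hx, hcl x hx y hy, hxy⟩
    · rw [List.isChain_iff_forall_rel_of_append_cons_cons] at hΓ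
      push Not at hΓ
      obtain ⟨x, y, l₁, l₂, rfl, hxy⟩ := hΓ
      have hperm : ((y :: l₂) ++ (l₁ ++ [x])).Perm (l₁ ++ x :: y :: l₂) := by
        rw [show l₁ ++ x :: y :: l₂ = (l₁ ++ [x]) ++ (y :: l₂) by simp]
        exact List.perm_append_comm
      rw [List.isChain_append_cons_cons] at hch
      refine ⟨(y :: l₂) ++ (l₁ ++ [x]), x, y, hperm.nodup_iff.2 hnd, ?_, ?_, by simp,
        by rw [← List.append_assoc]; exact List.getLast?_concat, hch.2.1, hxy⟩
      · rw [← hl]; exact List.toFinset_eq_of_perm _ _ hperm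
      · rw [List.isChain_append]
        refine ⟨hch.2.2, hch.1, ?_⟩
        intro u hu v hv
        refine hcl u ?_ v ?_
        · simpa using hu
        · obtain _ | ⟨c, l₁⟩ := l₁
          · simpa using hv
          · simpa using hv
  obtain ⟨l', x, y, hnd', hl', hch', hy, hx, hxy, hxy'⟩ := rot
  have hlen' : 3 ≤ l'.length := by rwa [← List.toFinset_card_of_nodup hnd', hl']
  have hchΓ : l'.IsChain Γ.Adj := by
    rw [List.isChain_iff_getElem] at hch' ⊢
    intro i hi
    by_contra hc
    have h1 := hadj _ _ (hch' i hi) hc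
    have h2 := hadj _ _ hxy hxy'
    have hy0 : l'[0] = y := by
      rw [List.head?_eq_getElem?, List.getElem?_eq_getElem (by omega)] at hy
      simpa using hy
    have hxl : l'[l'.length - 1] = x := by
      rw [List.getLast?_eq_getElem?, List.getElem?_eq_getElem (by omega)] at hx
      simpa using hx
    have e : ∀ j k (hj : j < l'.length) (hk : k < l'.length), l'[j] = l'[k] → j = k := by
      intro j k hj hk h
      exact (hnd'.getElem_inj_iff).1 h
    have hxne : x ≠ y := hxy.ne
    -- A second use of the new edge inside the chain would make its two ends consecutive, which
    -- needs a list of length two.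
    have hcase : (l'[i] = x ∧ l'[i+1] = y) ∨ (l'[i] = y ∧ l'[i+1] = x) := by grind
    rcases hcase with ⟨h3, h4⟩ | ⟨h3, h4⟩
    · have := e (i + 1) 0 hi (by omega) (h4.trans hy0.symm)
      omega
    · have := e i 0 (by omega) (by omega) (h3.trans hy0.symm)
      have := e (i + 1) (l'.length - 1) hi (by omega) (h4.trans hxl.symm)
      omega
  rcases hadj _ _ hxy hxy' with ⟨rfl, rfl⟩ | ⟨rfl, rfl⟩
  · refine ⟨l'.reverse, List.nodup_reverse.2 hnd', by simpa using hl', ?_, by simpa using hx,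
      by simpa using hy⟩
    rw [List.isChain_reverse]
    exact hchΓ.imp fun _ _ h => h.symm
  · exact ⟨l', hnd', hl', hchΓ, hy, hx⟩

theorem hasCyclicOrder_of_complete {Γ : SimpleGraph V} {A B : Finset V} (hdis : Disjoint A B)
    (hcard : #A = #B) (hpos : 1 ≤ #A) (hΓ : ∀ a ∈ A, ∀ b ∈ B, Γ.Adj a b) :
    HasCyclicOrder Γ (A ∪ B) := by
  have key : ∀ m : ℕ, ∀ A B : Finset V, Disjoint A B → #A = m + 1 → #B = m + 1 →
      (∀ a ∈ A, ∀ b ∈ B, Γ.Adj a b) → ∃ l : List V, l.Nodup ∧ l.toFinset = A ∪ B ∧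
        l.IsChain Γ.Adj ∧ (∀ y ∈ l.head?, y ∈ A) ∧ (∀ x ∈ l.getLast?, x ∈ B) := by
    intro m
    induction m with
    | zero =>
      intro A B hd hA hB h
      obtain ⟨a, rfl⟩ := Finset.card_eq_one.1 hA
      obtain ⟨b, rfl⟩ := Finset.card_eq_one.1 hB
      refine ⟨[a, b], ?_, ?_, ?_, ?_, ?_⟩
      · simpa using hd
      · ext; simp
      · simpa using h
      · simp
      · simp
    | succ m ih =>
      intro A B hd hA hB h
      obtain ⟨a, ha⟩ : A.Nonempty := Finset.card_pos.1 (by omega)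
      obtain ⟨b, hb⟩ : B.Nonempty := Finset.card_pos.1 (by omega)
      have hd' : ∀ x, x ∈ A → x ∈ B → False := fun x h1 h2 => Finset.disjoint_left.1 hd h1 h2
      obtain ⟨l, hnd, hl, hch, hh, hla⟩ := ih (A.erase a) (B.erase b)
        (hd.mono (Finset.erase_subset _ _) (Finset.erase_subset _ _))
        (by rw [Finset.card_erase_of_mem ha]; omega) (by rw [Finset.card_erase_of_mem hb]; omega)
        (fun x hx y hy => h x (Finset.mem_of_mem_erase hx) y (Finset.mem_of_mem_erase hy))
      have hmem : ∀ x, x ∈ l ↔ (x ≠ a ∧ x ∈ A) ∨ (x ≠ b ∧ x ∈ B) := by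
        intro x; rw [← List.mem_toFinset, hl]; simp
      have hne : l ≠ [] := by
        rintro rfl
        have : #(A.erase a) = 0 := by
          rw [Finset.card_eq_zero]
          exact (Finset.union_eq_empty.1 hl.symm).1
        rw [Finset.card_erase_of_mem ha] at this
        omega
      refine ⟨a :: b :: l, ?_, ?_, ?_, ?_, ?_⟩
      · have := hd' a ha
        have := hd' b
        simp only [List.nodup_cons, List.mem_cons, hmem]
        grind
      · ext x
        simp only [List.mem_toFinset, List.mem_cons, hmem, Finset.mem_union]
        grind
      · rw [List.isChain_cons_cons, List.isChain_cons]
        exact ⟨h a ha b hb, fun y hy => (h y (Finset.mem_of_mem_erase (hh y hy)) b hb).symm, hch⟩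
      · simpa using ha
      · intro x hx
        obtain _ | ⟨c, l⟩ := l
        · exact (hne rfl).elim
        · exact Finset.mem_of_mem_erase (hla x (by simpa [List.getLast?_cons_cons] using hx))
  obtain ⟨l, h1, h2, h3, h4, h5⟩ := key (#A - 1) A B hdis (by omega) (by omega) hΓ
  exact ⟨l, h1, h2, h3, fun x hx y hy => (hΓ y (h4 y hy) x (h5 x hx)).symm⟩

open Classical in
/-- A balanced bipartite graph in which most vertices have degree more than half of the other side
is Hamiltonian, provided the remaining vertices have degree exceeding their own number. -/
theorem hasCyclicOrder_of_degrees [Finite V] {R : SimpleGraph V} {A B A₁ B₁ : Finset V}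
    (hdis : Disjoint A B) (hcard : #A = #B) (hpos : 2 ≤ #A) (hA₁ : A₁ ⊆ A) (hB₁ : B₁ ⊆ B)
    (hdA₁ : ∀ a ∈ A₁, #A + 1 ≤ 2 * #{y ∈ B | R.Adj a y})
    (hdB₁ : ∀ b ∈ B₁, #A + 1 ≤ 2 * #{x ∈ A | R.Adj b x})
    (hdA : ∀ a ∈ A, #(A \ A₁) + 1 ≤ #{y ∈ B | R.Adj a y})
    (hdB : ∀ b ∈ B, #(B \ B₁) + 1 ≤ #{x ∈ A | R.Adj b x}) :
    HasCyclicOrder R (A ∪ B) := by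
  have hd' : ∀ x, x ∈ A → x ∈ B → False := fun x h1 h2 => Finset.disjoint_left.1 hdis h1 h2
  -- Edges inside `A` or inside `B` are dropped, since the crossing argument needs a bipartite
  -- graph.
  let Γ₀ : SimpleGraph V :=
    { Adj := fun u v => R.Adj u v ∧ ((u ∈ A ∧ v ∈ B) ∨ (u ∈ B ∧ v ∈ A))
      symm := ⟨fun u v h => ⟨h.1.symm, by tauto⟩⟩
      loopless := ⟨fun u h => h.1.ne rfl⟩ }
  by_contra hR
  have h₀ : ¬ HasCyclicOrder Γ₀ (A ∪ B) := by
    rintro ⟨l, h1, h2, h3, h4⟩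
    exact hR ⟨l, h1, h2, h3.imp fun _ _ h => h.1, fun x hx y hy => (h4 x hx y hy).1⟩
  -- An edge-maximal counterexample replaces the iterated closure: adding any missing cross edge
  -- makes it Hamiltonian, so pairs of large degree sum are already adjacent.
  obtain ⟨Γ, hΓ₀, hΓ⟩ := (Set.toFinite {Γ : SimpleGraph V | IsBetween Γ A B ∧
    ¬ HasCyclicOrder Γ (A ∪ B)}).exists_le_maximal (a := Γ₀) ⟨fun u v h => h.2, h₀⟩
  have hbet : IsBetween Γ A B := hΓ.prop.1
  have hcardAB : 3 ≤ #(A ∪ B) := by rw [Finset.card_union_of_disjoint hdis]; omega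
  have clos : ∀ a ∈ A, ∀ b ∈ B, #A + 1 ≤ #{y ∈ B | Γ.Adj a y} + #{x ∈ A | Γ.Adj b x} →
      Γ.Adj a b := by
    intro a ha b hb hdeg
    by_contra hnadj
    have hab : a ≠ b := fun h => hd' a ha (h ▸ hb)
    have hbet' : IsBetween (Γ ⊔ SimpleGraph.edge a b) A B := by
      intro u v h
      rw [SimpleGraph.sup_adj, SimpleGraph.edge_adj] at h
      rcases h with h | h
      · exact hbet u v h
      · grind
    have hham : HasCyclicOrder (Γ ⊔ SimpleGraph.edge a b) (A ∪ B) := by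
      by_contra hno
      have hle := hΓ.le_of_ge ⟨hbet', hno⟩ le_sup_left
      exact hnadj (hle (by rw [SimpleGraph.sup_adj, SimpleGraph.edge_adj]; grind))
    obtain ⟨l, hnd, hl, hch, hh, hla⟩ :=
      exists_path_of_cyclicOrder_sup_edge hcardAB hham hΓ.prop.2
    exact hΓ.prop.2 (hasCyclicOrder_of_path hdis hbet ha hb l hnd hl hch hh hla hdeg)
  have monoA : ∀ a ∈ A, #{y ∈ B | R.Adj a y} ≤ #{y ∈ B | Γ.Adj a y} := by
    intro a ha
    refine Finset.card_le_card fun y hy => ?_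
    rw [Finset.mem_filter] at hy ⊢
    exact ⟨hy.1, hΓ₀ ⟨hy.2, Or.inl ⟨ha, hy.1⟩⟩⟩
  have monoB : ∀ b ∈ B, #{x ∈ A | R.Adj b x} ≤ #{x ∈ A | Γ.Adj b x} := by
    intro b hb
    refine Finset.card_le_card fun y hy => ?_
    rw [Finset.mem_filter] at hy ⊢
    exact ⟨hy.1, hΓ₀ ⟨hy.2, Or.inr ⟨hb, hy.1⟩⟩⟩
  -- Three rounds of closure, `A₁ × B₁`, then `A × B₁`, then `A × B`; each raises the degrees that
  -- the next one needs.
  have s1 : ∀ a ∈ A₁, ∀ b ∈ B₁, Γ.Adj a b := by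
    intro a ha b hb
    have := monoA a (hA₁ ha)
    have := monoB b (hB₁ hb)
    have := hdA₁ a ha
    have := hdB₁ b hb
    exact clos a (hA₁ ha) b (hB₁ hb) (by omega)
  have cA : #(A \ A₁) + #A₁ = #A := Finset.card_sdiff_add_card_eq_card hA₁
  have cB : #(B \ B₁) + #B₁ = #B := Finset.card_sdiff_add_card_eq_card hB₁
  have s2 : ∀ a ∈ A, ∀ b ∈ B₁, Γ.Adj a b := by
    intro a ha b hb
    have h1 : #A₁ ≤ #{x ∈ A | Γ.Adj b x} := Finset.card_le_card fun x hx =>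
      Finset.mem_filter.2 ⟨hA₁ hx, (s1 x hx b hb).symm⟩
    have := monoA a ha
    have := hdA a ha
    exact clos a ha b (hB₁ hb) (by omega)
  have s3 : ∀ a ∈ A, ∀ b ∈ B, Γ.Adj a b := by
    intro a ha b hb
    have h1 : #B₁ ≤ #{y ∈ B | Γ.Adj a y} := Finset.card_le_card fun x hx =>
      Finset.mem_filter.2 ⟨hB₁ hx, s2 a ha x hx⟩
    have := monoB b hb
    have := hdB b hb
    exact clos a ha b hb (by omega)
  exact hΓ.prop.2 (hasCyclicOrder_of_complete hdis hcard (by omega) s3)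

end Hamilton

/-! ### Short cycles through prescribed vertices, built greedily from common neighbours. -/

section ShortCycle

variable {V : Type*}

open Classical in
/-- Any two vertices of `P` have at least `N` common neighbours in `C`. -/
def HasCommonNbrs (K : SimpleGraph V) (P C : Finset V) (N : ℕ) : Prop :=
  ∀ u ∈ P, ∀ v ∈ P, N ≤ #{x ∈ C | K.Adj u x ∧ K.Adj v x}

theorem HasCommonNbrs.exists_common {K : SimpleGraph V} {P C : Finset V} {N : ℕ}
    (h : HasCommonNbrs K P C N) {u v : V} (hu : u ∈ P) (hv : v ∈ P) (F : Finset V)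
    (hF : #F < N) : ∃ x ∈ C, x ∉ F ∧ K.Adj u x ∧ K.Adj v x := by
  classical
  obtain ⟨x, hx, hxF⟩ := Finset.exists_mem_notMem_of_card_lt_card (hF.trans_le (h u hu v hv))
  rw [Finset.mem_filter] at hx
  exact ⟨x, hx.1, hxF, hx.2.1, hx.2.2⟩

variable [DecidableEq V]

theorem HasCommonNbrs.exists_path {K : SimpleGraph V} {P C : Finset V} {N : ℕ}
    (h : HasCommonNbrs K P C N) (hCP : C ⊆ P) (s : ℕ) : ∀ u ∈ P, ∀ v ∈ P, ∀ F : Finset V,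
    #F + s < N → ∃ l : List V, l.length = s + 1 ∧ l.Nodup ∧ (∀ x ∈ l, x ∈ C ∧ x ∉ F) ∧
      (u :: (l ++ [v])).IsChain K.Adj := by
  induction s with
  | zero =>
    intro u hu v hv F hF
    obtain ⟨x, hxC, hxF, hux, hvx⟩ := h.exists_common hu hv F hF
    exact ⟨[x], rfl, by simp, by simp [hxC, hxF], by simp [hux, hvx.symm]⟩
  | succ s ih =>
    intro u hu v hv F hF
    obtain ⟨x, hxC, hxF, hux, -⟩ := h.exists_common hu hu F (by omega)
    obtain ⟨l, hl, hnd, hmem, hch⟩ := ih x (hCP hxC) v hv (insert x F) (by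
      have := Finset.card_insert_le x F
      omega)
    refine ⟨x :: l, by simp [hl], ?_, ?_, ?_⟩
    · rw [List.nodup_cons]
      exact ⟨fun hx => (hmem x hx).2 (Finset.mem_insert_self _ _), hnd⟩
    · intro y hy
      rcases List.mem_cons.1 hy with rfl | hy
      · exact ⟨hxC, hxF⟩
      · exact ⟨(hmem y hy).1, fun hyF => (hmem y hy).2 (Finset.mem_insert_of_mem hyF)⟩
    · rw [List.cons_append, List.isChain_cons_cons]
      exact ⟨hux, hch⟩

theorem HasCommonNbrs.exists_cycle {K : SimpleGraph V} {P C : Finset V} {N : ℕ}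
    (h : HasCommonNbrs K P C N) (hCP : C ⊆ P) (s : ℕ) (u : V) (hu : u ∈ P) (hs : s + 1 < N) :
    ∃ D ⊆ C, u ∉ D ∧ #D = s ∧ IsCycleSet K (insert u D : Finset V) := by
  obtain _ | _ | s := s
  · exact ⟨∅, by simp, by simp, by simp, Or.inr (Or.inl ⟨u, by simp⟩)⟩
  · obtain ⟨x, hxC, -, hux, -⟩ := h.exists_common hu hu ∅ (by simp; omega)
    exact ⟨{x}, by simpa using hxC, by simpa using hux.ne, by simp,
      Or.inr (Or.inr (Or.inl ⟨u, x, hux, by simp⟩))⟩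
  · obtain ⟨l, hl, hnd, hmem, hch⟩ := h.exists_path hCP (s + 1) u hu u hu {u}
      (by simp; omega)
    refine ⟨l.toFinset, fun x hx => (hmem x (by simpa using hx)).1, fun hx => ?_, ?_, ?_⟩
    · exact (hmem u (by simpa using hx)).2 (by simp)
    · rw [List.toFinset_card_of_nodup hnd, hl]
    · rw [← List.cons_append, List.isChain_append] at hch
      convert isCycleSet_of_list (G := K) (u :: l) (by simp [hl]) ?_ hch.1 ?_ using 1
      · ext; simp
      · rw [List.nodup_cons]
        exact ⟨fun hx => (hmem u hx).2 (by simp), hnd⟩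
      · intro x hx y hy
        simp only [List.head?_cons, Option.mem_def, Option.some.injEq] at hy
        subst hy
        exact hch.2.2 x hx _ (by simp)

/-- The vertices of `W` are threaded one after another, consecutive ones being joined through a
fresh common neighbour in `C`. -/
theorem HasCommonNbrs.exists_chain {K : SimpleGraph V} {P C : Finset V} {N : ℕ}
    (h : HasCommonNbrs K P C N) (W F : Finset V) (hWP : W ⊆ P) (hWF : W ⊆ F)
    (hne : W.Nonempty) (hN : #F + #W < N) :
    ∃ (l : List V) (D : Finset V), l.Nodup ∧ D ⊆ C ∧ Disjoint D F ∧ #D + 1 = #W ∧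
      l.toFinset = W ∪ D ∧ l.IsChain K.Adj ∧ (∃ a ∈ W, l.head? = some a) ∧
      ∃ b ∈ W, l.getLast? = some b := by
  induction hne using Finset.Nonempty.cons_induction with
  | singleton a =>
    exact ⟨[a], ∅, by simp, by simp, by simp, by simp, by simp, by simp, ⟨a, by simp⟩, a, by simp⟩
  | cons a W ha hne ih =>
    rw [Finset.cons_eq_insert] at *
    have hWF' := (Finset.subset_insert a W).trans hWF
    have hcard := Finset.card_insert_of_notMem ha
    obtain ⟨l, D, hnd, hDC, hDF, hD, hl, hch, ⟨c, hcW, hc⟩, b, hbW, hb⟩ :=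
      ih ((Finset.subset_insert a W).trans hWP) hWF' (by omega)
    obtain ⟨x, hxC, hxF, hax, hcx⟩ := h.exists_common
      (hWP (Finset.mem_insert_self a W)) (hWP (Finset.mem_insert_of_mem hcW)) (F ∪ D)
      (by have := Finset.card_union_le F D; omega)
    rw [Finset.notMem_union] at hxF
    have haF : a ∈ F := hWF (Finset.mem_insert_self a W)
    have hmem : ∀ y, y ∈ l ↔ y ∈ W ∨ y ∈ D := fun y => by
      rw [← List.mem_toFinset, hl, Finset.mem_union]
    refine ⟨a :: x :: l, insert x D, ?_, ?_, ?_, ?_, ?_, ?_, ⟨a, by simp⟩, b, by simp [hbW], ?_⟩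
    · simp only [List.nodup_cons, List.mem_cons, hmem]
      refine ⟨?_, ?_, hnd⟩
      · rintro (h | h | h)
        · exact hax.ne h
        · exact ha h
        · exact Finset.disjoint_left.1 hDF h haF
      · rintro (h | h)
        · exact hxF.1 (hWF' h)
        · exact hxF.2 h
    · exact Finset.insert_subset hxC hDC
    · exact Finset.disjoint_insert_left.2 ⟨hxF.1, hDF⟩
    · rw [Finset.card_insert_of_notMem hxF.2, hcard, hD]
    · ext y
      simp only [List.toFinset_cons, hl, Finset.mem_insert, Finset.mem_union]
      tauto
    · rw [List.isChain_cons_cons, List.isChain_cons]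
      refine ⟨hax, ?_, hch⟩
      intro y hy
      rw [hc] at hy
      simp only [Option.mem_def, Option.some.injEq] at hy
      exact hy ▸ hcx.symm
    · obtain _ | ⟨c', l⟩ := l
      · simp at hc
      · simpa [List.getLast?_cons_cons] using hb

/-- The cycle absorbs `W` and takes exactly `d` more vertices from `A` than from `B`, so deleting it
repairs an imbalance of `d`. No edge between `A` and `B` is assumed: the cycle passes from one side
to the other only at vertices of `W`. -/
theorem exists_short_cycle {K : SimpleGraph V} {W A B : Finset V} {N d : ℕ}
    (hAB : Disjoint A B) (hAW : Disjoint A W) (hBW : Disjoint B W)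
    (hA : HasCommonNbrs K (A ∪ W) A N) (hB : HasCommonNbrs K (B ∪ W) B N) (hneA : A.Nonempty)
    (hN : 3 * #W + d + 5 < N) :
    ∃ DA ⊆ A, ∃ DB ⊆ B, #DA = #DB + d ∧ #DB ≤ #W ∧
      IsCycleSet K (W ∪ DA ∪ DB : Finset V) := by
  have hWA : W ⊆ A ∪ W := Finset.subset_union_right
  have hWB : W ⊆ B ∪ W := Finset.subset_union_right
  rcases Nat.lt_or_ge 1 #W with hW | hW
  · obtain ⟨w, hw⟩ : W.Nonempty := Finset.card_pos.1 (by omega)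
    have hcard := Finset.card_erase_of_mem hw
    have hins : insert w (W.erase w) = W := Finset.insert_erase hw
    obtain ⟨l, D, hnd, hDA, hDW, hD, hl, hch, ⟨a, haW, ha⟩, b, hbW, hb⟩ :=
      hA.exists_chain (W.erase w) W ((Finset.erase_subset _ _).trans hWA)
        (Finset.erase_subset _ _) (Finset.card_pos.1 (by omega)) (by omega)
    have hmem : ∀ y, y ∈ l ↔ (y ≠ w ∧ y ∈ W) ∨ y ∈ D := fun y => by
      rw [← List.mem_toFinset, hl, Finset.mem_union, Finset.mem_erase]
    -- The cycle is `w`, then `s + 1` vertices of `A`, the chain through the rest of `W`, then `m +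
    -- 1` vertices of `B`. One of the two connecting paths is lengthened to make the difference
    -- exactly `d`.
    obtain ⟨s, m, hsm, hm, hs⟩ : ∃ s m : ℕ, #D + (s + 1) = m + 1 + d ∧ m + 1 ≤ #W ∧
        s ≤ d + 1 := by
      rcases Nat.lt_or_ge (#W) (d + 3) with h | h
      · exact ⟨d + 2 - #W, 0, by omega, by omega, by omega⟩
      · exact ⟨0, #W - 2 - d, by omega, by omega, by omega⟩
    obtain ⟨l₁, hl₁, hnd₁, hmem₁, hch₁⟩ := hA.exists_path Finset.subset_union_left s w (hWA hw) a
      (hWA (Finset.mem_of_mem_erase haW)) (W ∪ D)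
      (by have := Finset.card_union_le W D; omega)
    obtain ⟨l₂, hl₂, hnd₂, hmem₂, hch₂⟩ := hB.exists_path Finset.subset_union_left m b
      (hWB (Finset.mem_of_mem_erase hbW)) w (hWB hw) W (by omega)
    have hdAB : ∀ x, x ∈ A → x ∈ B → False := fun x h₁ h₂ => Finset.disjoint_left.1 hAB h₁ h₂
    have hdAW : ∀ x, x ∈ A → x ∈ W → False := fun x h₁ h₂ => Finset.disjoint_left.1 hAW h₁ h₂
    have hdBW : ∀ x, x ∈ B → x ∈ W → False := fun x h₁ h₂ => Finset.disjoint_left.1 hBW h₁ h₂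
    have hdl₁ : Disjoint D l₁.toFinset := by
      rw [Finset.disjoint_left]
      intro x hx hx'
      exact (hmem₁ x (by simpa using hx')).2 (Finset.mem_union_right _ hx)
    refine ⟨D ∪ l₁.toFinset, ?_, l₂.toFinset, ?_, ?_, ?_, ?_⟩
    · refine Finset.union_subset hDA fun x hx => (hmem₁ x (by simpa using hx)).1
    · exact fun x hx => (hmem₂ x (by simpa using hx)).1
    · rw [Finset.card_union_of_disjoint hdl₁, List.toFinset_card_of_nodup hnd₁,
        List.toFinset_card_of_nodup hnd₂, hl₁, hl₂]
      exact hsm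
    · rw [List.toFinset_card_of_nodup hnd₂, hl₂]
      exact hm
    · have hw₁ : w ∉ l₁ := fun h => (hmem₁ w h).2 (Finset.mem_union_left _ hw)
      have hw₂ : w ∉ l₂ := fun h => (hmem₂ w h).2 hw
      have hwl : w ∉ l := fun h => by
        rcases (hmem w).1 h with h | h
        · exact h.1 rfl
        · exact hdAW w (hDA h) hw
      rw [← List.cons_append, List.isChain_append] at hch₁
      have hch₂' := hch₂
      rw [List.isChain_cons, List.isChain_append] at hch₂
      have hne₂ : l₂ ≠ [] := by rintro rfl; simp at hl₂
      convert isCycleSet_of_list (G := K) ((w :: l₁) ++ (l ++ l₂)) ?_ ?_ ?_ ?_ using 1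
      · ext x
        simp only [Finset.coe_union, List.coe_toFinset, Set.mem_union, Finset.mem_coe,
          Set.mem_ofPred_eq, List.mem_append, List.mem_cons, hmem]
        have : x = w → x ∈ W := fun h => h ▸ hw
        by_cases hxw : x = w
        · simp [hxw, hw]
        · simp only [hxw]
          tauto
      · simp [hl₁, hl₂]
        omega
      · rw [List.nodup_append', List.nodup_append', List.nodup_cons]
        refine ⟨⟨hw₁, hnd₁⟩, ⟨hnd, hnd₂, ?_⟩, ?_⟩
        · intro x hx hx'
          have := hmem₂ x hx'
          rcases (hmem x).1 hx with h | h
          · exact this.2 h.2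
          · exact hdAB x (hDA h) this.1
        · intro x hx hx'
          rcases List.mem_cons.1 hx with rfl | hx
          · rcases List.mem_append.1 hx' with h | h
            · exact hwl h
            · exact hw₂ h
          · have h1 := hmem₁ x hx
            rcases List.mem_append.1 hx' with h | h
            · rcases (hmem x).1 h with h | h
              · exact h1.2 (Finset.mem_union_left _ h.2)
              · exact h1.2 (Finset.mem_union_right _ h)
            · exact hdAB x h1.1 (hmem₂ x h).1
      · rw [List.isChain_append, List.isChain_append]
        refine ⟨hch₁.1, ⟨hch, hch₂.2.1, ?_⟩, ?_⟩
        · intro x hx y hy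
          rw [hb] at hx
          simp only [Option.mem_def, Option.some.injEq] at hx
          subst hx
          exact hch₂.1 y (by rw [List.head?_append]; simp [Option.mem_def.1 hy])
        · intro x hx y hy
          refine hch₁.2.2 x hx y ?_
          rw [List.head?_append, ha] at hy
          simpa using hy
      · intro x hx y hy
        simp only [List.cons_append, List.head?_cons, Option.mem_def, Option.some.injEq] at hy
        subst hy
        refine hch₂.2.2.2 x ?_ _ (by simp)
        rw [List.getLast?_append, List.getLast?_append, List.getLast?_eq_some_getLast hne₂] at hx
        rw [List.getLast?_eq_some_getLast hne₂]
        simpa using hx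
  -- With at most one vertex in `W` the cycle cannot visit both sides, so it takes `d` vertices of
  -- `A` and none of `B`.
  · rcases Nat.eq_zero_or_pos #W with h0 | h0
    · have hW0 := Finset.card_eq_zero.1 h0
      subst hW0
      obtain _ | d := d
      · exact ⟨∅, by simp, ∅, by simp, by simp, by simp, Or.inl (by simp)⟩
      · obtain ⟨u, hu⟩ := hneA
        obtain ⟨D, hD, huD, hDc, hcyc⟩ := hA.exists_cycle Finset.subset_union_left d u
          (Finset.mem_union_left _ hu) (by omega)
        refine ⟨insert u D, Finset.insert_subset hu hD, ∅, by simp, ?_, by simp, ?_⟩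
        · rw [Finset.card_insert_of_notMem huD, hDc]; simp
        · simpa using hcyc
    · obtain ⟨w, rfl⟩ := Finset.card_eq_one.1 (show #W = 1 by omega)
      obtain ⟨D, hD, huD, hDc, hcyc⟩ := hA.exists_cycle Finset.subset_union_left d w
          (Finset.mem_union_right _ (by simp)) (by omega)
      refine ⟨D, hD, ∅, by simp, by simp [hDc], by simp, ?_⟩
      simpa using hcyc

end ShortCycle

/-! ### Real-valued degrees into finite sets. -/

section Counting

variable {V : Type*}

open Classical in
/-- The number of neighbours of `v` in the finite set `S`, as a real number. -/
noncomputable def deg (R : SimpleGraph V) (v : V) (S : Finset V) : ℝ := #{x ∈ S | R.Adj v x}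

theorem deg_nonneg (R : SimpleGraph V) (v : V) (S : Finset V) : 0 ≤ deg R v S :=
  Nat.cast_nonneg _

theorem deg_le_card (R : SimpleGraph V) (v : V) (S : Finset V) : deg R v S ≤ #S := by
  classical
  exact Nat.cast_le.2 (Finset.card_filter_le _ _)

theorem deg_mono (R : SimpleGraph V) (v : V) {S T : Finset V} (h : S ⊆ T) :
    deg R v S ≤ deg R v T := by
  classical
  exact Nat.cast_le.2 (Finset.card_le_card (Finset.filter_subset_filter _ h))

/-- Every vertex is joined in `R` or `B` to all but at most `c` of the vertices of any set. -/
def MissAtMost (R B : SimpleGraph V) (c : ℝ) : Prop :=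
  ∀ (v : V) (S : Finset V), (#S : ℝ) ≤ deg R v S + deg B v S + c

theorem card_mul_le_of_deg {K : SimpleGraph V} {A B : Finset V} {s t : ℝ}
    (hA : ∀ a ∈ A, s ≤ deg K a B) (hB : ∀ b ∈ B, deg K b A ≤ t) : #A * s ≤ #B * t := by
  classical
  have h := Finset.sum_card_bipartiteAbove_eq_sum_card_bipartiteBelow (s := A) (t := B) K.Adj
  have h1 : (#A : ℝ) * s ≤ ∑ a ∈ A, (#(Finset.bipartiteAbove K.Adj B a) : ℝ) := by
    rw [← nsmul_eq_mul]
    refine Finset.card_nsmul_le_sum _ _ _ fun a ha => ?_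
    have := hA a ha
    unfold deg at this
    simpa only [Finset.bipartiteAbove] using this
  have h2 : ∑ b ∈ B, (#(Finset.bipartiteBelow K.Adj A b) : ℝ) ≤ (#B : ℝ) * t := by
    rw [← nsmul_eq_mul]
    refine Finset.sum_le_card_nsmul _ _ _ fun b hb => ?_
    have := hB b hb
    unfold deg at this
    simpa only [Finset.bipartiteBelow, K.adj_comm b] using this
  have h3 : ∑ a ∈ A, (#(Finset.bipartiteAbove K.Adj B a) : ℝ) =
      ∑ b ∈ B, (#(Finset.bipartiteBelow K.Adj A b) : ℝ) := by exact_mod_cast h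
  linarith

variable [DecidableEq V]

theorem deg_union_le (R : SimpleGraph V) (v : V) (S T : Finset V) :
    deg R v (S ∪ T) ≤ deg R v S + deg R v T := by
  classical
  unfold deg
  rw [Finset.filter_union]
  exact_mod_cast Finset.card_union_le _ _

theorem deg_union (R : SimpleGraph V) (v : V) {S T : Finset V} (h : Disjoint S T) :
    deg R v (S ∪ T) = deg R v S + deg R v T := by
  classical
  unfold deg
  rw [Finset.filter_union, Finset.card_union_of_disjoint
    (h.mono (Finset.filter_subset _ _) (Finset.filter_subset _ _))]
  push_cast
  rfl

theorem deg_le_add (R : SimpleGraph V) (v : V) {S T U : Finset V} (h : S ⊆ T ∪ U) :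
    deg R v S ≤ deg R v T + #U :=
  (deg_mono R v h).trans ((deg_union_le R v T U).trans (by have := deg_le_card R v U; linarith))

theorem deg_le_deg_add (R : SimpleGraph V) (v : V) {S T U : Finset V} (h : S ⊆ T ∪ U) :
    deg R v S ≤ deg R v T + deg R v U :=
  (deg_mono R v h).trans (deg_union_le R v T U)

theorem hasCommonNbrs_of_deg {K : SimpleGraph V} {P C : Finset V} {N : ℕ}
    (h : ∀ u ∈ P, (#C + N : ℝ) ≤ 2 * deg K u C) : HasCommonNbrs K P C N := by
  classical
  intro u hu v hv
  have h1 := h u hu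
  have h2 := h v hv
  unfold deg at h1 h2
  have h3 : #{x ∈ C | K.Adj u x} + #{x ∈ C | K.Adj v x} ≤
      #C + #{x ∈ C | K.Adj u x ∧ K.Adj v x} := by
    rw [← Finset.card_union_add_card_inter, ← Finset.filter_and]
    exact Nat.add_le_add_right (Finset.card_le_card
      (Finset.union_subset (Finset.filter_subset _ _) (Finset.filter_subset _ _))) _
  have h4 : (#{x ∈ C | K.Adj u x} + #{x ∈ C | K.Adj v x} : ℝ) ≤
      #C + #{x ∈ C | K.Adj u x ∧ K.Adj v x} := by exact_mod_cast h3
  have h5 : (N : ℝ) ≤ (#{x ∈ C | K.Adj u x ∧ K.Adj v x} : ℝ) := by linarith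
  convert (Nat.cast_le.1 h5)

theorem cast_card_sdiff {S T : Finset V} (h : T ⊆ S) : (#(S \ T) : ℝ) = #S - #T := by
  rw [Finset.card_sdiff_of_subset h, Nat.cast_sub (Finset.card_le_card h)]

theorem card_le_add_of_subset {S T U : Finset V} (h : S ⊆ T ∪ U) : (#S : ℝ) ≤ #T + #U := by
  exact_mod_cast (Finset.card_le_card h).trans (Finset.card_union_le _ _)

end Counting

/-! ### The cycle partition in the near-extremal configuration. -/

section CyclePartition

variable {V : Type*} [Fintype V] [DecidableEq V]

/-- A short `K`-cycle swallows `W` and the excess of `A` over `B`; the balanced remainder carries an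
`R`-cycle. The short cycle takes at most `L` vertices from either side, which is the slack in the
degree hypotheses. `A₁` and `B₁` hold the typical vertices. -/
theorem cyclePartition_of_split {R K : SimpleGraph V} {A B W A₁ B₁ : Finset V} {N : ℕ} {L : ℝ}
    (hAB : Disjoint A B) (hAW : Disjoint A W) (hBW : Disjoint B W)
    (huniv : ∀ v, v ∈ A ∨ v ∈ B ∨ v ∈ W) (hA₁ : A₁ ⊆ A) (hB₁ : B₁ ⊆ B) (hle : #B ≤ #A)
    (hL : (#W + (#A - #B) : ℝ) ≤ L) (hcA : HasCommonNbrs K (A₁ ∪ W) A₁ N)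
    (hcB : HasCommonNbrs K (B₁ ∪ W) B₁ N) (hne : A₁.Nonempty) (hN : 3 * L + 5 < N)
    (hBL : L + 2 ≤ #B)
    (hRA₁ : ∀ a ∈ A₁, #B + 1 + 2 * L ≤ 2 * deg R a B)
    (hRB₁ : ∀ b ∈ B₁, #A + 1 + 2 * L ≤ 2 * deg R b A)
    (hRA : ∀ a ∈ A, #(A \ A₁) + 1 + L ≤ deg R a B)
    (hRB : ∀ b ∈ B, #(B \ B₁) + 1 + L ≤ deg R b A) :
    ∃ S : Set V, IsCycleSet R S ∧ IsCycleSet K Sᶜ := by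
  classical
  have hle' : (#B : ℝ) ≤ #A := by exact_mod_cast hle
  have hN' : 3 * #W + (#A - #B) + 5 < N := by
    have : ((3 * #W + (#A - #B) + 5 : ℕ) : ℝ) < N := by
      push_cast [Nat.cast_sub hle]
      linarith
    exact_mod_cast this
  obtain ⟨DA, hDA, DB, hDB, hcard, hDBW, hcyc⟩ := exists_short_cycle
    (hAB.mono hA₁ hB₁) (hAW.mono_left hA₁) (hBW.mono_left hB₁) hcA hcB hne hN'
  have hDA' := hDA.trans hA₁
  have hDB' := hDB.trans hB₁
  have hcardR : (#DA : ℝ) = #DB + (#A - #B) := by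
    rw [hcard]
    push_cast [Nat.cast_sub hle]
    ring
  have hDBR : (#DB : ℝ) ≤ #W := by exact_mod_cast hDBW
  have c1 := cast_card_sdiff hDA'
  have c2 := cast_card_sdiff hDB'
  have hW0 : (0 : ℝ) ≤ #W := Nat.cast_nonneg _
  have hDB0 : (0 : ℝ) ≤ #DB := Nat.cast_nonneg _
  have heq : #(A \ DA) = #(B \ DB) := by
    have : (#(A \ DA) : ℝ) = #(B \ DB) := by linarith
    exact_mod_cast this
  have hdis : Disjoint (A \ DA) (B \ DB) := hAB.mono Finset.sdiff_subset Finset.sdiff_subset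
  have two : 2 ≤ #(A \ DA) := by
    have : (2 : ℝ) ≤ #(A \ DA) := by linarith
    exact_mod_cast this
  have eB : ∀ v, deg R v B ≤ deg R v (B \ DB) + #DB := fun v =>
    deg_le_add R v (by rw [Finset.sdiff_union_of_subset hDB'])
  have eA : ∀ v, deg R v A ≤ deg R v (A \ DA) + #DA := fun v =>
    deg_le_add R v (by rw [Finset.sdiff_union_of_subset hDA'])
  have sA : (#((A \ DA) \ (A₁ \ DA)) : ℝ) ≤ #(A \ A₁) := by
    refine Nat.cast_le.2 (Finset.card_le_card fun x hx => ?_)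
    simp only [Finset.mem_sdiff] at hx ⊢
    tauto
  have sB : (#((B \ DB) \ (B₁ \ DB)) : ℝ) ≤ #(B \ B₁) := by
    refine Nat.cast_le.2 (Finset.card_le_card fun x hx => ?_)
    simp only [Finset.mem_sdiff] at hx ⊢
    tauto
  have ham := hasCyclicOrder_of_degrees (R := R) (A := A \ DA) (B := B \ DB) (A₁ := A₁ \ DA)
    (B₁ := B₁ \ DB) hdis heq two (Finset.sdiff_subset_sdiff hA₁ le_rfl)
    (Finset.sdiff_subset_sdiff hB₁ le_rfl)
    (fun a ha => by
      have h1 := hRA₁ a (Finset.mem_sdiff.1 ha).1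
      have h2 := eB a
      have : (#(A \ DA) + 1 : ℝ) ≤ 2 * deg R a (B \ DB) := by linarith
      unfold deg at this
      exact_mod_cast this)
    (fun b hb => by
      have h1 := hRB₁ b (Finset.mem_sdiff.1 hb).1
      have h2 := eA b
      have : (#(A \ DA) + 1 : ℝ) ≤ 2 * deg R b (A \ DA) := by linarith
      unfold deg at this
      exact_mod_cast this)
    (fun a ha => by
      have h1 := hRA a (Finset.mem_sdiff.1 ha).1
      have h2 := eB a
      have : (#((A \ DA) \ (A₁ \ DA)) + 1 : ℝ) ≤ deg R a (B \ DB) := by linarith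
      unfold deg at this
      exact_mod_cast this)
    (fun b hb => by
      have h1 := hRB b (Finset.mem_sdiff.1 hb).1
      have h2 := eA b
      have : (#((B \ DB) \ (B₁ \ DB)) + 1 : ℝ) ≤ deg R b (A \ DA) := by linarith
      unfold deg at this
      exact_mod_cast this)
  refine ⟨_, ham.isCycleSet (by rw [Finset.card_union_of_disjoint hdis]; omega), ?_⟩
  convert hcyc using 1
  ext v
  have h1 := huniv v
  have h2 : v ∈ A → v ∉ B := fun h => Finset.disjoint_left.1 hAB h
  have h3 : v ∈ A → v ∉ W := fun h => Finset.disjoint_left.1 hAW h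
  have h4 : v ∈ B → v ∉ W := fun h => Finset.disjoint_left.1 hBW h
  have h5 : v ∈ DA → v ∈ A := fun h => hDA' h
  have h6 : v ∈ DB → v ∈ B := fun h => hDB' h
  simp only [Set.mem_compl_iff, Finset.mem_coe, Finset.mem_union, Finset.mem_sdiff]
  tauto

/-- As `R` is sparse inside the halves, `K` is dense there; as `K` is sparse between them, `R` has
degree above `n/4` across. Every other vertex joins a side to whose opposite it has some `R`-edges,
or else has `K`-degree above one half into both sides and goes to `W`. -/
theorem cyclePartition_of_sparse_pair {R K : SimpleGraph V} {γ τ n : ℝ}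
    (hn : n = Fintype.card V) (hτ : 0 < τ) (hτγ : 100 * τ ≤ γ) (hγ : γ ≤ 1 / 4)
    (hbig : 4 ≤ τ * n) (hmiss : MissAtMost R K ((1 / 4 - γ) * n)) {A₀ B₀ : Finset V}
    (hdis : Disjoint A₀ B₀) (hA₀ : (1 / 2 - τ) * n ≤ #A₀) (hB₀ : (1 / 2 - τ) * n ≤ #B₀)
    (hRA : ∀ a ∈ A₀, deg R a A₀ ≤ τ * n) (hRB : ∀ b ∈ B₀, deg R b B₀ ≤ τ * n)
    (hKB : ∀ b ∈ B₀, deg K b A₀ ≤ τ ^ 2 * n) :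
    ∃ S : Set V, IsCycleSet R S ∧ IsCycleSet K Sᶜ := by
  classical
  have hn0 : 0 < n := by
    rcases lt_or_ge 0 n with h | h
    · exact h
    · nlinarith
  have hγn : 100 * (τ * n) ≤ γ * n := by nlinarith
  have hγn4 : γ * n ≤ n / 4 := by nlinarith
  have hcardle : ∀ S : Finset V, (#S : ℝ) ≤ n := fun S => by
    rw [hn]; exact_mod_cast Finset.card_le_univ S
  have hdisj2 : ∀ S T : Finset V, Disjoint S T → (#S + #T : ℝ) ≤ n := fun S T h => by
    have := hcardle (S ∪ T)
    rw [Finset.card_union_of_disjoint h] at this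
    exact_mod_cast this
  have hd' : ∀ x, x ∈ A₀ → x ∈ B₀ → False := fun x h1 h2 => Finset.disjoint_left.1 hdis h1 h2
  -- The `K`-sparsity is assumed only from `B₀`. Double counting with the bound `τ ^ 2 * n` leaves
  -- at most `τ * n` vertices of `A₀` that violate the bound `τ * n`.
  set E : Finset V := {a ∈ A₀ | τ * n ≤ deg K a B₀} with hE
  set A₁ := A₀ \ E with hA₁
  have hEsub : E ⊆ A₀ := Finset.filter_subset _ _
  have hEcard : (#E : ℝ) ≤ τ * n := by
    have h1 := card_mul_le_of_deg (K := K) (A := E) (B := B₀) (s := τ * n) (t := τ ^ 2 * n)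
      (fun a ha => (Finset.mem_filter.1 ha).2)
      (fun b hb => (deg_mono K b hEsub).trans (hKB b hb))
    have h2 := hcardle B₀
    have h3 : (#E : ℝ) * (τ * n) ≤ (τ * n) * (τ * n) := by
      nlinarith [mul_le_mul_of_nonneg_right h2 (by positivity : 0 ≤ τ ^ 2 * n)]
    exact le_of_mul_le_mul_right h3 (by positivity)
  have hA₁card : (#A₁ : ℝ) = #A₀ - #E := cast_card_sdiff hEsub
  have hA₁sub : A₁ ⊆ A₀ := Finset.sdiff_subset
  have hKA₁ : ∀ a ∈ A₁, deg K a B₀ ≤ τ * n := fun a ha => by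
    by_contra h
    exact (Finset.mem_sdiff.1 ha).2 (Finset.mem_filter.2 ⟨hA₁sub ha, (not_le.1 h).le⟩)
  set A : Finset V := {v | γ * n / 2 ≤ deg R v B₀} with hA
  set B : Finset V := {v | ¬ γ * n / 2 ≤ deg R v B₀ ∧ γ * n / 2 ≤ deg R v A₀} with hB
  set W : Finset V := {v | ¬ γ * n / 2 ≤ deg R v B₀ ∧ ¬ γ * n / 2 ≤ deg R v A₀} with hW
  have hAB : Disjoint A B := by
    rw [Finset.disjoint_left]; intro x h1 h2
    simp only [hA, hB, Finset.mem_filter, Finset.mem_univ, true_and] at h1 h2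
    exact h2.1 h1
  have hAW : Disjoint A W := by
    rw [Finset.disjoint_left]; intro x h1 h2
    simp only [hA, hW, Finset.mem_filter, Finset.mem_univ, true_and] at h1 h2
    exact h2.1 h1
  have hBW : Disjoint B W := by
    rw [Finset.disjoint_left]; intro x h1 h2
    simp only [hB, hW, Finset.mem_filter, Finset.mem_univ, true_and] at h1 h2
    exact h2.2 h1.2
  have huniv : ∀ v, v ∈ A ∨ v ∈ B ∨ v ∈ W := fun v => by
    simp only [hA, hB, hW, Finset.mem_filter, Finset.mem_univ, true_and]
    tauto
  have rA₁ : ∀ a ∈ A₁, n / 4 + γ * n - 2 * (τ * n) ≤ deg R a B₀ := fun a ha => by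
    have := hmiss a B₀
    have := hKA₁ a ha
    linarith
  have hτ1 : τ ^ 2 * n ≤ τ * n := by
    have : τ ≤ 1 := by linarith
    nlinarith [mul_pos hτ hn0]
  have rB₀ : ∀ b ∈ B₀, n / 4 + γ * n - 2 * (τ * n) ≤ deg R b A₀ := fun b hb => by
    have := hmiss b A₀
    have := hKB b hb
    linarith
  have hA₁A : A₁ ⊆ A := fun a ha => by
    simp only [hA, Finset.mem_filter, Finset.mem_univ, true_and]
    have := rA₁ a ha
    linarith
  have hB₀B : B₀ ⊆ B := fun b hb => by
    simp only [hB, Finset.mem_filter, Finset.mem_univ, true_and]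
    have := rB₀ b hb
    have := hRB b hb
    constructor <;> linarith
  have hdW : Disjoint (A₁ ∪ B₀) W := Finset.disjoint_union_left.2
    ⟨hAW.mono_left hA₁A, hBW.mono_left hB₀B⟩
  have hd₁ : Disjoint A₁ B₀ := hdis.mono_left hA₁sub
  have hcW : (#W : ℝ) ≤ 3 * (τ * n) := by
    have h1 := hdisj2 _ _ hdW
    rw [Finset.card_union_of_disjoint hd₁] at h1
    push_cast at h1
    linarith
  have hcA : (#A : ℝ) ≤ n / 2 + τ * n := by
    have := hdisj2 _ _ (hAB.mono_right hB₀B)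
    linarith
  have hcB : (#B : ℝ) ≤ n / 2 + 2 * (τ * n) := by
    have := hdisj2 _ _ (hAB.mono_left hA₁A)
    linarith
  have hcA' : (#A₁ : ℝ) ≤ #A := by exact_mod_cast Finset.card_le_card hA₁A
  have hcB' : (#B₀ : ℝ) ≤ #B := by exact_mod_cast Finset.card_le_card hB₀B
  -- Both sets have about `n / 2` vertices, so these degrees exceed half by about `γ * n / 2`; this
  -- is the use of the surplus `γ`.
  have wK : ∀ w ∈ W, (#A₁ : ℝ) - n / 4 + γ * n / 2 ≤ deg K w A₁ ∧
      (#B₀ : ℝ) - n / 4 + γ * n / 2 ≤ deg K w B₀ := fun w hw => by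
    simp only [hW, Finset.mem_filter, Finset.mem_univ, true_and, not_le] at hw
    have := hmiss w A₁
    have := hmiss w B₀
    have := deg_mono R w hA₁sub
    constructor <;> linarith [hw.1, hw.2]
  -- The value 25 exceeds `3 * 7`: below, `L = 7 * (τ * n)` bounds `#W` (at most `3 * (τ * n)`) plus
  -- the imbalance (at most `4 * (τ * n)`), and `3 * L + 5 < N` is required.
  obtain ⟨N, hN1, hN2⟩ : ∃ N : ℕ, (25 * (τ * n) : ℝ) ≤ N ∧ (N : ℝ) ≤ 25 * (τ * n) + 1 :=
    ⟨⌈25 * (τ * n)⌉₊, Nat.le_ceil _, (Nat.ceil_lt_add_one (by positivity)).le⟩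
  have hcomA : HasCommonNbrs K (A₁ ∪ W) A₁ N := hasCommonNbrs_of_deg fun u hu => by
    rcases Finset.mem_union.1 hu with hu | hu
    · have := hmiss u A₁
      have := (deg_mono R u hA₁sub).trans (hRA u (hA₁sub hu))
      linarith
    · have := (wK u hu).1
      linarith
  have hcomB : HasCommonNbrs K (B₀ ∪ W) B₀ N := hasCommonNbrs_of_deg fun u hu => by
    rcases Finset.mem_union.1 hu with hu | hu
    · have := hmiss u B₀
      have := hRB u hu
      linarith
    · have := (wK u hu).2
      linarith
  have sA : (#(A \ A₁) : ℝ) ≤ 3 * (τ * n) := by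
    rw [cast_card_sdiff hA₁A]
    linarith
  have sB : (#(B \ B₀) : ℝ) ≤ 4 * (τ * n) := by
    rw [cast_card_sdiff hB₀B]
    linarith
  have dA : ∀ a ∈ A, γ * n / 2 ≤ deg R a B := fun a ha => by
    simp only [hA, Finset.mem_filter, Finset.mem_univ, true_and] at ha
    exact ha.trans (deg_mono R a hB₀B)
  have dA₀ : ∀ v, deg R v A₀ ≤ deg R v A + τ * n := fun v => by
    have := deg_le_add R v (show A₀ ⊆ A ∪ E from fun x hx => by
      by_cases h : x ∈ E
      · exact Finset.mem_union_right _ h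
      · exact Finset.mem_union_left _ (hA₁A (Finset.mem_sdiff.2 ⟨hx, h⟩)))
    linarith
  have dB : ∀ b ∈ B, γ * n / 2 - τ * n ≤ deg R b A := fun b hb => by
    simp only [hB, Finset.mem_filter, Finset.mem_univ, true_and] at hb
    have := dA₀ b
    linarith [hb.2]
  have neA : A₁.Nonempty := by
    rw [← Finset.card_pos]
    have : (0 : ℝ) < #A₁ := by linarith
    exact_mod_cast this
  have neB : B₀.Nonempty := by
    rw [← Finset.card_pos]
    have : (0 : ℝ) < #B₀ := by linarith
    exact_mod_cast this
  have dA₁ : ∀ a ∈ A₁, n / 4 + γ * n - 3 * (τ * n) ≤ deg R a B := fun a ha => by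
    have := rA₁ a ha
    have := deg_mono R a hB₀B
    linarith
  have dB₀ : ∀ b ∈ B₀, n / 4 + γ * n - 3 * (τ * n) ≤ deg R b A := fun b hb => by
    have := rB₀ b hb
    have := dA₀ b
    linarith
  rcases le_total #B #A with h | h
  · refine cyclePartition_of_split (N := N) (L := 7 * (τ * n)) hAB hAW hBW huniv hA₁A hB₀B h ?_
      hcomA hcomB neA ?_ ?_ ?_ ?_ ?_ ?_
    · linarith
    · linarith
    · linarith
    · intro a ha; have := dA₁ a ha; linarith
    · intro b hb; have := dB₀ b hb; linarith
    · intro a ha; have := dA a ha; linarith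
    · intro b hb; have := dB b hb; linarith
  · refine cyclePartition_of_split (N := N) (L := 7 * (τ * n)) hAB.symm hBW hAW
      (fun v => by have := huniv v; tauto) hB₀B hA₁A h ?_
      hcomB hcomA neB ?_ ?_ ?_ ?_ ?_ ?_
    · linarith
    · linarith
    · linarith
    · intro b hb; have := dB₀ b hb; linarith
    · intro a ha; have := dA₁ a ha; linarith
    · intro b hb; have := dB b hb; linarith
    · intro a ha; have := dA a ha; linarith

end CyclePartition

/-! ### Counting adjacent ordered pairs. -/

section Pairs

variable {V : Type*}

/-- The number of ordered pairs in `X × Y` that are adjacent in `R`. -/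
noncomputable def pairs (R : SimpleGraph V) (X Y : Finset V) : ℝ := ∑ x ∈ X, deg R x Y

theorem pairs_eq_card (R : SimpleGraph V) (X Y : Finset V) [DecidableRel R.Adj] :
    pairs R X Y = #{p ∈ X ×ˢ Y | R.Adj p.1 p.2} := by
  classical
  unfold pairs deg
  rw [Finset.card_filter, Finset.sum_product, Nat.cast_sum]
  refine Finset.sum_congr rfl fun x _ => ?_
  rw [Finset.card_filter]
  congr!

theorem pairs_comm (R : SimpleGraph V) (X Y : Finset V) : pairs R X Y = pairs R Y X := by
  classical
  have h := Finset.sum_card_bipartiteAbove_eq_sum_card_bipartiteBelow (s := X) (t := Y) R.Adj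
  have h1 : pairs R X Y = ∑ x ∈ X, (#(Finset.bipartiteAbove R.Adj Y x) : ℝ) :=
    Finset.sum_congr rfl fun x _ => by simp only [deg, Finset.bipartiteAbove]
  have h2 : pairs R Y X = ∑ y ∈ Y, (#(Finset.bipartiteBelow R.Adj X y) : ℝ) :=
    Finset.sum_congr rfl fun y _ => by simp only [deg, Finset.bipartiteBelow, R.adj_comm y]
  rw [h1, h2]
  exact_mod_cast h

theorem pairs_nonneg (R : SimpleGraph V) (X Y : Finset V) : 0 ≤ pairs R X Y :=
  Finset.sum_nonneg fun _ _ => deg_nonneg _ _ _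

theorem pairs_mono (R : SimpleGraph V) {X X' Y Y' : Finset V} (hX : X ⊆ X') (hY : Y ⊆ Y') :
    pairs R X Y ≤ pairs R X' Y' :=
  (Finset.sum_le_sum fun x _ => deg_mono R x hY).trans
    (Finset.sum_le_sum_of_subset_of_nonneg hX fun _ _ _ => deg_nonneg _ _ _)

theorem mul_le_pairs (R : SimpleGraph V) {X Y : Finset V} {s : ℝ}
    (h : ∀ x ∈ X, s ≤ deg R x Y) : #X * s ≤ pairs R X Y := by
  rw [← nsmul_eq_mul]
  exact Finset.card_nsmul_le_sum _ _ _ h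

theorem pairs_le_mul (R : SimpleGraph V) {X Y : Finset V} {s : ℝ}
    (h : ∀ x ∈ X, deg R x Y ≤ s) : pairs R X Y ≤ #X * s := by
  rw [← nsmul_eq_mul]
  exact Finset.sum_le_card_nsmul _ _ _ h

variable [DecidableEq V]

theorem pairs_insert_self (R : SimpleGraph V) {Y : Finset V} {x : V} (hx : x ∉ Y) :
    pairs R (insert x Y) (insert x Y) = pairs R Y Y + 2 * deg R x Y := by
  classical
  have h0 : ∀ y, deg R y (insert x Y) = deg R y {x} + deg R y Y := fun y => by
    rw [Finset.insert_eq, deg_union R y (by simpa using hx)]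
  have h1 : deg R x {x} = 0 := by simp [deg, Finset.filter_singleton]
  have h2 : pairs R Y {x} = deg R x Y := by rw [pairs_comm]; simp [pairs]
  unfold pairs at h2
  simp only [pairs]
  rw [Finset.sum_insert hx, Finset.sum_congr rfl fun y _ => h0 y, Finset.sum_add_distrib, h0, h1, h2]
  ring

theorem pairs_union_right_le (R : SimpleGraph V) (X Y Y' : Finset V) :
    pairs R X (Y ∪ Y') ≤ pairs R X Y + pairs R X Y' := by
  unfold pairs
  rw [← Finset.sum_add_distrib]
  exact Finset.sum_le_sum fun x _ => deg_union_le R x Y Y'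

end Pairs

/-! ### From pair counts to edge counts and robustness. -/

section EdgeCount

variable {V : Type*} {G : SimpleGraph V}

theorem edgeCount_comm (H : G.Subgraph) (A B : Set V) : edgeCount H A B = edgeCount H B A := by
  unfold edgeCount
  congr 1
  ext e
  constructor
  · rintro ⟨he, a, ha, b, hb, rfl⟩
    exact ⟨he, b, hb, a, ha, Sym2.eq_swap⟩
  · rintro ⟨he, a, ha, b, hb, rfl⟩
    exact ⟨he, b, hb, a, ha, Sym2.eq_swap⟩

theorem ncard_neighborSet_eq_deg (H : G.Subgraph) {S : Finset V} (hS : H.verts = S) (v : V) :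
    ((H.neighborSet v).ncard : ℝ) = deg H.spanningCoe v S := by
  classical
  unfold deg
  rw [← Set.ncard_coe_finset]
  congr 2
  ext w
  simp only [SimpleGraph.Subgraph.mem_neighborSet, Finset.coe_filter, Set.mem_ofPred_eq,
    SimpleGraph.Subgraph.spanningCoe_adj]
  exact ⟨fun h => ⟨by rw [← Finset.mem_coe, ← hS]; exact h.snd_mem, h⟩, fun h => h.2⟩

/-- The subgraph of `R` induced on a finite set of vertices. -/
abbrev inducedOn (R : SimpleGraph V) (S : Finset V) : R.Subgraph :=
  (⊤ : R.Subgraph).induce (S : Set V)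

theorem deg_inducedOn {R : SimpleGraph V} {S Y : Finset V} (hY : Y ⊆ S) {v : V} (hv : v ∈ S) :
    deg (inducedOn R S).spanningCoe v Y = deg R v Y := by
  classical
  unfold deg
  congr 2
  refine Finset.filter_congr fun y hy => ?_
  simp [hv, hY hy]

theorem pairs_inducedOn {R : SimpleGraph V} {S X Y : Finset V} (hX : X ⊆ S) (hY : Y ⊆ S) :
    pairs (inducedOn R S).spanningCoe X Y = pairs R X Y :=
  Finset.sum_congr rfl fun _ hx => deg_inducedOn hY (hX hx)

variable [DecidableEq V]

theorem edgeCount_eq_card_image (H : G.Subgraph) (A B : Finset V)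
    [DecidableRel H.spanningCoe.Adj] : edgeCount H A B =
      #(({p ∈ A ×ˢ B | H.spanningCoe.Adj p.1 p.2}).image fun p => s(p.1, p.2)) := by
  unfold edgeCount
  rw [← Set.ncard_coe_finset]
  congr 1
  ext e
  simp only [Set.mem_ofPred_eq, Finset.coe_image, Set.mem_image, Finset.mem_coe, Finset.mem_filter,
    Finset.mem_product, Prod.exists, SimpleGraph.Subgraph.spanningCoe_adj]
  constructor
  · rintro ⟨he, a, ha, b, hb, rfl⟩
    exact ⟨a, b, ⟨⟨ha, hb⟩, he⟩, rfl⟩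
  · rintro ⟨a, b, ⟨⟨ha, hb⟩, he⟩, rfl⟩
    exact ⟨he, a, ha, b, hb, rfl⟩

theorem edgeCount_le_pairs (H : G.Subgraph) (A B : Finset V) :
    (edgeCount H A B : ℝ) ≤ pairs H.spanningCoe A B := by
  classical
  rw [edgeCount_eq_card_image, pairs_eq_card]
  exact_mod_cast Finset.card_image_le

theorem pairs_le_edgeCount (H : G.Subgraph) (A B : Finset V) :
    pairs H.spanningCoe A B ≤ 2 * (edgeCount H A B : ℝ) := by
  classical
  rw [edgeCount_eq_card_image, pairs_eq_card]
  have := Finset.card_le_mul_card_image (f := fun p : V × V => s(p.1, p.2))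
    ({p ∈ A ×ˢ B | H.spanningCoe.Adj p.1 p.2}) 2 (fun e _ => by
      induction e using Sym2.inductionOn with
      | hf x y =>
        refine (Finset.card_le_card (t := {(x, y), (y, x)}) fun p hp => ?_).trans Finset.card_le_two
        have := (Finset.mem_filter.1 hp).2
        rw [Sym2.eq_iff] at this
        simp only [Finset.mem_insert, Finset.mem_singleton, Prod.ext_iff]
        exact this)
  exact_mod_cast this

variable [Fintype V]

/-- Only cuts with two large sides need checking: on a side with at most `η n / 2` vertices, each
vertex sends at least half of its required degree `η n` across. Pairs count edges up to twice,
whence `4 * α ≤ η`. -/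
theorem isRobust_of_cuts {H : G.Subgraph} {S : Finset V} (hS : H.verts = S) {η α : ℝ}
    (hα : 0 ≤ α) (hαη : 4 * α ≤ η)
    (hmin : ∀ v ∈ S, η * Fintype.card V ≤ deg H.spanningCoe v S)
    (hcut : ∀ Z ⊆ S, η * Fintype.card V / 2 ≤ #Z → η * Fintype.card V / 2 ≤ #(S \ Z) →
      α * #Z * #(S \ Z) ≤ edgeCount H Z (S \ Z : Finset V)) : IsRobust η α H := by
  classical
  refine ⟨fun v hv => ?_, ?_⟩
  · rw [ncard_neighborSet_eq_deg H hS]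
    exact hmin v (by rwa [hS] at hv)
  have small : ∀ Z ⊆ S, #Z ≤ η * Fintype.card V / 2 →
      α * #Z * #(S \ Z) ≤ edgeCount H Z (S \ Z : Finset V) := by
    intro Z hZ hZs
    have h1 : #Z * (η * Fintype.card V / 2) ≤ pairs H.spanningCoe Z (S \ Z) :=
      mul_le_pairs _ fun z hz => by
        have h2 := deg_le_add H.spanningCoe z (show S ⊆ (S \ Z) ∪ Z by
          rw [Finset.sdiff_union_of_subset hZ])
        have h3 := hmin z (hZ hz)
        linarith
    have h2 := pairs_le_edgeCount H Z (S \ Z)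
    have h3 : (#(S \ Z) : ℝ) ≤ Fintype.card V := by exact_mod_cast Finset.card_le_univ _
    have h4 : α * #Z * #(S \ Z) ≤ α * #Z * Fintype.card V :=
      mul_le_mul_of_nonneg_left h3 (by positivity)
    have h5 : 4 * α * (#Z * Fintype.card V) ≤ η * (#Z * Fintype.card V) :=
      mul_le_mul_of_nonneg_right hαη (by positivity)
    linarith
  rintro ⟨X, hX, hlt⟩
  obtain ⟨Z, rfl⟩ : ∃ Z : Finset V, (Z : Set V) = X := ⟨X.toFinset, by simp⟩
  rw [hS, Finset.coe_subset] at hX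
  rw [hS, ← Finset.coe_sdiff, Set.ncard_coe_finset, Set.ncard_coe_finset] at hlt
  rcases le_total (#Z : ℝ) (η * Fintype.card V / 2) with h1 | h1
  · exact absurd (small Z hX h1) (not_le.2 hlt)
  rcases le_total (#(S \ Z) : ℝ) (η * Fintype.card V / 2) with h2 | h2
  · have := small (S \ Z) Finset.sdiff_subset h2
    rw [Finset.sdiff_sdiff_eq_self hX, edgeCount_comm] at this
    linarith
  · exact absurd (hcut Z hX h1 h2) (not_le.2 hlt)

end EdgeCount

/-! ### Robust closure of a set without sparse balanced cuts. -/

section Closure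

variable {V : Type*} [DecidableEq V]

/-- `hQ` says that `S` grows from `S₀` by adding vertices with `θ` earlier neighbours. Peeling `X \
S₀` in that order, each of the `k` vertices has all but `#(X ∩ S₀) + k` of these neighbours outside
`X`. -/
theorem exists_peel {R : SimpleGraph V} {S₀ S X : Finset V} {θ : ℝ}
    (hQ : ∀ T ⊆ S \ S₀, T.Nonempty → ∃ v ∈ T, θ ≤ deg R v (S \ T)) (hX : X ⊆ S) (k : ℕ)
    (hk : k ≤ #(X \ S₀)) :
    ∃ T ⊆ X \ S₀, #T = k ∧ k * (θ - #(X ∩ S₀) - k) ≤ pairs R T (S \ X) := by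
  induction k with
  | zero => exact ⟨∅, by simp, by simp, by simp [pairs]⟩
  | succ k ih =>
    obtain ⟨T, hT, hTk, hle⟩ := ih (by omega)
    obtain ⟨v, hv, hvd⟩ := hQ ((X \ S₀) \ T)
      (Finset.sdiff_subset.trans (Finset.sdiff_subset_sdiff hX le_rfl)) (by
        rw [← Finset.card_pos, Finset.card_sdiff_of_subset hT]
        omega)
    rw [Finset.mem_sdiff] at hv
    refine ⟨insert v T, Finset.insert_subset hv.1 hT, by
      rw [Finset.card_insert_of_notMem hv.2, hTk], ?_⟩
    have h1 : deg R v (S \ ((X \ S₀) \ T)) ≤ deg R v (S \ X) + #((X ∩ S₀) ∪ T) :=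
      deg_le_add R v fun x hx => by
        simp only [Finset.mem_sdiff, Finset.mem_union, Finset.mem_inter] at hx ⊢
        tauto
    have h2 : (#((X ∩ S₀) ∪ T) : ℝ) ≤ #(X ∩ S₀) + k := by
      rw [← hTk]; exact_mod_cast Finset.card_union_le _ _
    have h3 : pairs R (insert v T) (S \ X) = deg R v (S \ X) + pairs R T (S \ X) :=
      Finset.sum_insert hv.2
    rw [h3]
    push_cast
    have hk0 : (0 : ℝ) ≤ k := Nat.cast_nonneg k
    nlinarith

variable [Fintype V]

/-- Adding vertices of large degree one by one to a set without sparse balanced cuts yields an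
induced robust subgraph to which every outside vertex has small degree. -/
theorem exists_robust_closure {R : SimpleGraph V} {S₀ : Finset V} {η α ε : ℝ}
    (hη : 0 < η) (hα : 0 < α) (hαη : 32 * α ≤ η ^ 2) (hη1 : η ≤ 1) (hαε : 2 * α ≤ ε)
    (hn : 8 ≤ η * Fintype.card V)
    (hmin : ∀ v ∈ S₀, η * Fintype.card V ≤ deg R v S₀)
    (hcut : ∀ X ⊆ S₀, η * Fintype.card V / 4 ≤ #X → η * Fintype.card V / 4 ≤ #(S₀ \ X) →
      ε * (Fintype.card V : ℝ) ^ 2 ≤ pairs R X (S₀ \ X)) :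
    ∃ S, S₀ ⊆ S ∧ IsRobust η α (inducedOn R S) ∧
      ∀ v ∉ S, deg R v S < η * Fintype.card V := by
  classical
  set n : ℝ := (Fintype.card V : ℝ) with hndef
  -- An order-free form of "built from `S₀` one vertex at a time": the earliest vertex of `T` is the
  -- witness.
  let Q : Finset V → Prop := fun S => S₀ ⊆ S ∧
    ∀ T ⊆ S \ S₀, T.Nonempty → ∃ v ∈ T, η * n ≤ deg R v (S \ T)
  obtain ⟨S, hS⟩ := (Set.toFinite {S : Finset V | Q S}).exists_maximal
    ⟨S₀, le_rfl, fun T hT hne => by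
      rw [Finset.sdiff_self, Finset.subset_empty] at hT
      exact absurd hne (by simp [hT])⟩
  obtain ⟨hS₀, hQ⟩ := hS.prop
  have hout : ∀ v ∉ S, deg R v S < η * n := by
    intro v hv
    by_contra h
    rw [not_lt] at h
    have hQ' : Q (insert v S) := by
      refine ⟨hS₀.trans (Finset.subset_insert v S), fun T hT hne => ?_⟩
      by_cases hvT : v ∈ T
      · rcases (T.erase v).eq_empty_or_nonempty with he | he
        · refine ⟨v, hvT, h.trans (deg_mono R v fun x hx => ?_)⟩
          rw [Finset.mem_sdiff]
          refine ⟨Finset.mem_insert_of_mem hx, fun hxT => ?_⟩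
          have : x ∈ T.erase v := Finset.mem_erase.2 ⟨fun h => hv (h ▸ hx), hxT⟩
          simp [he] at this
        · obtain ⟨u, hu, hud⟩ := hQ (T.erase v) (fun x hx => by
            have := hT (Finset.mem_of_mem_erase hx)
            have := Finset.ne_of_mem_erase hx
            simp only [Finset.mem_sdiff, Finset.mem_insert] at *
            tauto) he
          refine ⟨u, Finset.mem_of_mem_erase hu, hud.trans (deg_mono R u fun x hx => ?_)⟩
          have : x = v → False := fun h => hv (h ▸ (Finset.mem_sdiff.1 hx).1)
          simp only [Finset.mem_sdiff, Finset.mem_insert, Finset.mem_erase] at *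
          tauto
      · obtain ⟨u, hu, hud⟩ := hQ T (fun x hx => by
          have := hT hx
          have : x ≠ v := fun h => hvT (h ▸ hx)
          simp only [Finset.mem_sdiff, Finset.mem_insert] at *
          tauto) hne
        exact ⟨u, hu, hud.trans (deg_mono R u
          (Finset.sdiff_subset_sdiff (Finset.subset_insert v S) le_rfl))⟩
    exact hv (hS.le_of_ge hQ' (Finset.subset_insert v S) (Finset.mem_insert_self v S))
  have hmin' : ∀ v ∈ S, η * n ≤ deg R v S := by
    intro v hv
    by_cases hv₀ : v ∈ S₀
    · exact (hmin v hv₀).trans (deg_mono R v hS₀)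
    · obtain ⟨u, hu, hud⟩ := hQ {v} (by simp [hv, hv₀]) (by simp)
      rw [Finset.mem_singleton] at hu
      subst hu
      exact hud.trans (deg_mono R u Finset.sdiff_subset)
  have hn0 : 0 < n := by
    by_contra h
    nlinarith
  have hedge : ∀ X ⊆ S, 2 * α * n ^ 2 ≤ pairs R X (S \ X) →
      α * #X * #(S \ X) ≤ edgeCount (inducedOn R S) X (S \ X : Finset V) := by
    intro X hX h
    have h1 := pairs_le_edgeCount (inducedOn R S) X (S \ X)
    rw [pairs_inducedOn hX Finset.sdiff_subset] at h1
    have h2 : (#X : ℝ) ≤ n := by rw [hndef]; exact_mod_cast Finset.card_le_univ _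
    have h3 : (#(S \ X) : ℝ) ≤ n := by rw [hndef]; exact_mod_cast Finset.card_le_univ _
    have h4 : (#X : ℝ) * #(S \ X) ≤ n * n := mul_le_mul h2 h3 (by positivity) hn0.le
    nlinarith
  -- A large side with little of `S₀` consists mostly of added vertices. Peeling about `η n / 4` of
  -- them, each sending `η n / 2` edges across, gives order `η ^ 2 * n ^ 2` pairs.
  have hunbal : ∀ X ⊆ S, η * n / 2 ≤ #X → #(X ∩ S₀) < η * n / 4 →
      2 * α * n ^ 2 ≤ pairs R X (S \ X) := by
    intro X hX hXc hXS
    have h1 : (#(X \ S₀) : ℝ) + #(X ∩ S₀) = #X := by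
      exact_mod_cast Finset.card_sdiff_add_card_inter X S₀
    have hk1 := Nat.floor_le (show 0 ≤ η * n / 4 by positivity)
    have hk2 := Nat.lt_floor_add_one (η * n / 4)
    obtain ⟨T, hT, -, hle⟩ := exists_peel hQ hX ⌊η * n / 4⌋₊ (by
      have : (⌊η * n / 4⌋₊ : ℝ) ≤ #(X \ S₀) := by linarith
      exact_mod_cast this)
    refine le_trans ?_ (hle.trans (pairs_mono R (hT.trans Finset.sdiff_subset) le_rfl))
    have h3 : η * n / 8 * (η * n / 2) ≤
        (⌊η * n / 4⌋₊ : ℝ) * (η * n - #(X ∩ S₀) - ⌊η * n / 4⌋₊) :=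
      mul_le_mul (by linarith) (by linarith) (by positivity) (by positivity)
    nlinarith [mul_le_mul_of_nonneg_right hαη (sq_nonneg n)]
  refine ⟨S, hS₀, isRobust_of_cuts (S := S) rfl hα.le (by nlinarith)
    (fun v hv => by rw [deg_inducedOn le_rfl hv]; exact hmin' v hv) ?_, hout⟩
  intro X hX h1 h2
  refine hedge X hX ?_
  rcases lt_or_ge (#(X ∩ S₀) : ℝ) (η * n / 4) with h3 | h3
  · exact hunbal X hX h1 h3
  rcases lt_or_ge (#((S \ X) ∩ S₀) : ℝ) (η * n / 4) with h4 | h4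
  · have := hunbal (S \ X) Finset.sdiff_subset h2 h4
    rwa [Finset.sdiff_sdiff_eq_self hX, pairs_comm] at this
  · have he : S₀ \ (X ∩ S₀) = (S \ X) ∩ S₀ := by
      ext x
      have := @hS₀ x
      simp only [Finset.mem_sdiff, Finset.mem_inter]
      tauto
    have h5 := hcut (X ∩ S₀) Finset.inter_subset_right h3 (by rw [he]; exact h4)
    rw [he] at h5
    have h6 := pairs_mono R (X := X ∩ S₀) (X' := X) (Y := (S \ X) ∩ S₀) (Y' := S \ X)
      Finset.inter_subset_left Finset.inter_subset_left
    nlinarith [mul_le_mul_of_nonneg_right hαε (sq_nonneg n)]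

end Closure

/-! ### Robust bipartitions of near-bipartite robust graphs. -/

section NearBipartite

variable {V : Type*} [DecidableEq V]

/-- In a cut minimising the inner pairs, moving a single vertex gains nothing, so each vertex has at
least half of its degree across. -/
theorem exists_max_cut (R : SimpleGraph V) (S : Finset V) :
    ∃ X ⊆ S, (∀ Z ⊆ S, pairs R X X + pairs R (S \ X) (S \ X) ≤
      pairs R Z Z + pairs R (S \ Z) (S \ Z)) ∧
      (∀ x ∈ X, deg R x S ≤ 2 * deg R x (S \ X)) ∧
      ∀ x ∈ S \ X, deg R x S ≤ 2 * deg R x X := by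
  classical
  obtain ⟨X, hX, hmin⟩ := Finset.exists_min_image S.powerset
    (fun X => pairs R X X + pairs R (S \ X) (S \ X)) ⟨∅, by simp⟩
  rw [Finset.mem_powerset] at hX
  have key : ∀ X ⊆ S, (∀ Z ⊆ S, pairs R X X + pairs R (S \ X) (S \ X) ≤
      pairs R Z Z + pairs R (S \ Z) (S \ Z)) → ∀ x ∈ X, deg R x S ≤ 2 * deg R x (S \ X) := by
    intro X hX hmin x hx
    have h1 := hmin (X.erase x) ((Finset.erase_subset x X).trans hX)
    have h2 := pairs_insert_self R (Finset.notMem_erase x X)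
    rw [Finset.insert_erase hx] at h2
    have h3 := pairs_insert_self R (show x ∉ S \ X by simp [hx])
    have h4 : S \ X.erase x = insert x (S \ X) := by
      ext y
      have := @hX x hx
      by_cases hxy : y = x
      · subst hxy; simp [this]
      · simp [hxy]
    have h5 : deg R x X ≤ deg R x (X.erase x) := by
      unfold deg
      refine Nat.cast_le.2 (Finset.card_le_card fun y hy => ?_)
      rw [Finset.mem_filter] at hy ⊢
      exact ⟨Finset.mem_erase.2 ⟨hy.2.ne', hy.1⟩, hy.2⟩
    have h6 := deg_le_deg_add R x (show S ⊆ X ∪ (S \ X) by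
      rw [Finset.union_sdiff_of_subset hX])
    rw [h4] at h1
    linarith
  have hmin' : ∀ Z ⊆ S, pairs R X X + pairs R (S \ X) (S \ X) ≤
      pairs R Z Z + pairs R (S \ Z) (S \ Z) := fun Z hZ => hmin Z (Finset.mem_powerset.2 hZ)
  refine ⟨X, hX, hmin', key X hX hmin', ?_⟩
  have := key (S \ X) Finset.sdiff_subset (by
    intro Z hZ
    rw [Finset.sdiff_sdiff_eq_self hX]
    have := hmin' Z hZ
    linarith)
  rwa [Finset.sdiff_sdiff_eq_self hX] at this

variable [Fintype V]

/-- A maximum cut works. It keeps half of every degree, and its inner edges number at most `α ^ 2 *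
n ^ 2`, few compared with the `α * η ^ 2 * n ^ 2 / 16` edges that robustness puts across any cut
with both sides at least `η n / 4`. -/
theorem exists_robust_bipartition {R : SimpleGraph V} {S : Finset V} {η α : ℝ}
    (hη : 0 < η) (hη1 : η ≤ 1) (hα : 0 < α) (hαη : 64 * α ≤ η ^ 2)
    (hrob : IsRobust η α (inducedOn R S)) (hnb : IsNearBipartite (α ^ 4) (inducedOn R S)) :
    ∃ X Y : Finset V, X ∪ Y = S ∧ Disjoint X Y ∧ #X ≤ #Y ∧
      IsBipartition (η / 2) (α ^ 2) (inducedOn R S) X Y ∧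
      IsRobust (η / 2) (α / 2) (betweenSubgraph (inducedOn R S) X Y) ∧
      pairs R X X ≤ α ^ 2 * (Fintype.card V : ℝ) ^ 2 ∧
      pairs R Y Y ≤ α ^ 2 * (Fintype.card V : ℝ) ^ 2 := by
  classical
  set n : ℝ := (Fintype.card V : ℝ) with hndef
  set H := inducedOn R S with hH
  have hverts : H.verts = (S : Set V) := rfl
  have hSn : (#S : ℝ) ≤ n := by rw [hndef]; exact_mod_cast Finset.card_le_univ _
  have hα1 : 64 * α ≤ 1 := by nlinarith
  have hmin : ∀ v ∈ S, η * n ≤ deg R v S := fun v hv => by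
    have := hrob.1 v hv
    rwa [ncard_neighborSet_eq_deg H hverts, deg_inducedOn le_rfl hv] at this
  obtain ⟨X, hX, hopt, hdX, hdY⟩ := exists_max_cut R S
  have hsmall : pairs R X X + pairs R (S \ X) (S \ X) < α ^ 2 * (#S : ℝ) ^ 2 := by
    obtain ⟨Z', hZ', h1, h2⟩ := hnb
    obtain ⟨Z, rfl⟩ : ∃ Z : Finset V, (Z : Set V) = Z' := ⟨Z'.toFinset, by simp⟩
    rw [hverts, Finset.coe_subset] at hZ'
    rw [hverts, Set.ncard_coe_finset] at h1 h2
    rw [← Finset.coe_sdiff] at h2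
    have h3 := pairs_le_edgeCount H Z Z
    have h4 := pairs_le_edgeCount H (S \ Z) (S \ Z)
    rw [pairs_inducedOn hZ' hZ'] at h3
    rw [pairs_inducedOn Finset.sdiff_subset Finset.sdiff_subset] at h4
    have h5 := hopt Z hZ'
    -- Strict near-bipartiteness fails for an empty vertex set, so `S` is nonempty.
    have hS0 : (0 : ℝ) < (#S : ℝ) ^ 2 := by
      have : (0 : ℝ) ≤ (edgeCount H Z Z : ℝ) := Nat.cast_nonneg _
      have h6 : 0 < α ^ 4 * (#S : ℝ) ^ 2 := lt_of_le_of_lt this h1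
      exact pos_of_mul_pos_right h6 (by positivity)
    have h7 : 4 * α ^ 4 ≤ α ^ 2 := by
      have : 4 * α ^ 2 ≤ 1 := by nlinarith
      nlinarith [sq_nonneg α]
    have h8 := mul_le_mul_of_nonneg_right h7 hS0.le
    linarith
  have hsn : α ^ 2 * (#S : ℝ) ^ 2 ≤ α ^ 2 * n ^ 2 := by gcongr
  have build : ∀ X Y : Finset V, X ∪ Y = S → Disjoint X Y → #X ≤ #Y →
      pairs R X X + pairs R Y Y < α ^ 2 * (#S : ℝ) ^ 2 →
      (∀ x ∈ X, deg R x S ≤ 2 * deg R x Y) → (∀ y ∈ Y, deg R y S ≤ 2 * deg R y X) →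
      ∃ X Y : Finset V, X ∪ Y = S ∧ Disjoint X Y ∧ #X ≤ #Y ∧
      IsBipartition (η / 2) (α ^ 2) H X Y ∧
      IsRobust (η / 2) (α / 2) (betweenSubgraph H X Y) ∧
      pairs R X X ≤ α ^ 2 * n ^ 2 ∧ pairs R Y Y ≤ α ^ 2 * n ^ 2 := by
    intro X Y hXY hdis hcard hs hdX hdY
    have hXS : X ⊆ S := hXY ▸ Finset.subset_union_left
    have hYS : Y ⊆ S := hXY ▸ Finset.subset_union_right
    have hpX := pairs_nonneg R X X
    have hpY := pairs_nonneg R Y Y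
    have eX : (edgeCount H X X : ℝ) ≤ pairs R X X :=
      (edgeCount_le_pairs H X X).trans_eq (pairs_inducedOn hXS hXS)
    have eY : (edgeCount H Y Y : ℝ) ≤ pairs R Y Y :=
      (edgeCount_le_pairs H Y Y).trans_eq (pairs_inducedOn hYS hYS)
    have degIn_eq : ∀ v ∈ S, ∀ T ⊆ S, (degIn H v T : ℝ) = deg R v T := by
      intro v hv T hT
      unfold degIn deg
      rw [← Set.ncard_coe_finset]
      congr 2
      ext w
      simp only [Set.mem_inter_iff, SimpleGraph.Subgraph.mem_neighborSet, Finset.mem_coe,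
        Finset.coe_filter, Set.mem_ofPred_eq, hH, SimpleGraph.Subgraph.induce_adj,
        SimpleGraph.Subgraph.top_adj]
      exact ⟨fun h => ⟨h.2, h.1.2.2⟩, fun h => ⟨⟨hv, hT h.1, h.2⟩, h.1⟩⟩
    have hbX : ∀ x ∈ X, η / 2 * n ≤ deg R x Y := fun x hx => by
      have := hdX x hx
      have := hmin x (hXS hx)
      linarith
    have hbY : ∀ y ∈ Y, η / 2 * n ≤ deg R y X := fun y hy => by
      have := hdY y hy
      have := hmin y (hYS hy)
      linarith
    have hSn' : η / 2 * (#S : ℝ) ≤ η / 2 * n := by gcongr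
    refine ⟨X, Y, hXY, hdis, hcard, ⟨?_, ?_, ?_, ?_, ?_, ?_⟩, ?_, by linarith, by linarith⟩
    · rw [← Finset.coe_union, hXY, hverts]
    · exact_mod_cast hdis
    · rw [hverts, Set.ncard_coe_finset]; linarith
    · rw [hverts, Set.ncard_coe_finset]; linarith
    · intro x hx
      rw [hverts, Set.ncard_coe_finset, degIn_eq x (hXS hx) Y hYS]
      exact hSn'.trans (hbX x hx)
    · intro y hy
      rw [hverts, Set.ncard_coe_finset, degIn_eq y (hYS hy) X hXS]
      exact hSn'.trans (hbY y hy)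
    · set H' := betweenSubgraph H X Y with hH'
      have hv' : H'.verts = (S : Set V) := by
        change H.verts ∩ ((X : Set V) ∪ Y) = S
        rw [← Finset.coe_union, hXY, hverts, Set.inter_self]
      have hadj : ∀ u v, H'.Adj u v ↔ H.Adj u v ∧ ((u ∈ X ∧ v ∈ Y) ∨ (u ∈ Y ∧ v ∈ X)) :=
        fun u v => Iff.rfl
      refine isRobust_of_cuts hv' (by positivity) (by nlinarith) ?_ ?_
      · intro v hv
        rw [← hXY, Finset.mem_union] at hv
        rcases hv with hv | hv
        · refine (hbX v hv).trans ?_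
          unfold deg
          refine Nat.cast_le.2 (Finset.card_le_card fun y hy => ?_)
          rw [Finset.mem_filter] at hy ⊢
          refine ⟨hYS hy.1, ?_⟩
          rw [SimpleGraph.Subgraph.spanningCoe_adj, hadj]
          exact ⟨⟨hXS hv, hYS hy.1, hy.2⟩, Or.inl ⟨hv, hy.1⟩⟩
        · refine (hbY v hv).trans ?_
          unfold deg
          refine Nat.cast_le.2 (Finset.card_le_card fun y hy => ?_)
          rw [Finset.mem_filter] at hy ⊢
          refine ⟨hXS hy.1, ?_⟩
          rw [SimpleGraph.Subgraph.spanningCoe_adj, hadj]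
          exact ⟨⟨hYS hv, hXS hy.1, hy.2⟩, Or.inr ⟨hv, hy.1⟩⟩
      · intro Z hZ h1 h2
        have h3 : α * #Z * #(S \ Z) ≤ edgeCount H Z (S \ Z : Finset V) := by
          by_contra hlt
          refine hrob.2 ⟨Z, by rw [hverts]; exact_mod_cast hZ, ?_⟩
          rw [hverts, ← Finset.coe_sdiff, Set.ncard_coe_finset, Set.ncard_coe_finset]
          exact not_le.1 hlt
        have h4 : edgeCount H Z (S \ Z : Finset V) ≤
            edgeCount H' Z (S \ Z : Finset V) + edgeCount H X X + edgeCount H Y Y := by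
          unfold edgeCount
          refine (Set.ncard_le_ncard (t := _ ∪ _ ∪ _) ?_ (Set.toFinite _)).trans
            ((Set.ncard_union_le _ _).trans (Nat.add_le_add_right (Set.ncard_union_le _ _) _))
          rintro e ⟨he, a, ha, b, hb, rfl⟩
          have haS : a ∈ X ∨ a ∈ Y := by
            rw [← Finset.mem_union, hXY]; exact hZ ha
          have hbS : b ∈ X ∨ b ∈ Y := by
            rw [← Finset.mem_union, hXY]; exact (Finset.mem_sdiff.1 hb).1
          rcases haS with h | h <;> rcases hbS with h' | h'
          · exact Or.inl (Or.inr ⟨he, a, h, b, h', rfl⟩)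
          · exact Or.inl (Or.inl ⟨⟨he, Or.inl ⟨h, h'⟩⟩, a, ha, b, hb, rfl⟩)
          · exact Or.inl (Or.inl ⟨⟨he, Or.inr ⟨h, h'⟩⟩, a, ha, b, hb, rfl⟩)
          · exact Or.inr ⟨he, a, h, b, h', rfl⟩
        have h4' : (edgeCount H Z (S \ Z : Finset V) : ℝ) ≤
            edgeCount H' Z (S \ Z : Finset V) + edgeCount H X X + edgeCount H Y Y := by
          exact_mod_cast h4
        have h5 : (η / 2 * n / 2) * (η / 2 * n / 2) ≤ (#Z : ℝ) * #(S \ Z) :=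
          mul_le_mul h1 h2 (by positivity) (by positivity)
        have h6 : 64 * α * (α * n ^ 2) ≤ η ^ 2 * (α * n ^ 2) :=
          mul_le_mul_of_nonneg_right hαη (by positivity)
        have h7 : α * ((η / 2 * n / 2) * (η / 2 * n / 2)) ≤ α * ((#Z : ℝ) * #(S \ Z)) :=
          mul_le_mul_of_nonneg_left h5 hα.le
        nlinarith
  rcases le_total #X #(S \ X) with h | h
  · exact build X (S \ X) (Finset.union_sdiff_of_subset hX) Finset.disjoint_sdiff h hsmall hdX hdY
  · exact build (S \ X) X (Finset.sdiff_union_of_subset hX) Finset.sdiff_disjoint h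
      (by linarith) hdY hdX

end NearBipartite

/-! ### The dichotomy, and the structure of the hulls it produces. -/

section Structure


/-- The hierarchy of constants, with `q = η ^ (1 / 3)` and `n` the number of vertices. -/
structure Constants (γ q α n : ℝ) : Prop where
  γ_le : γ ≤ 1 / 4
  q_pos : 0 < q
  q_le : 1000 * q ≤ γ
  α_pos : 0 < α
  α_le : 1000 * α ≤ q ^ 6
  n_large : 1 ≤ α * n

namespace Constants

variable {γ q α n : ℝ} (h : Constants γ q α n)
include h

theorem q_small : q ≤ 1 / 4000 := by linarith [h.γ_le, h.q_le]

theorem n_pos : 0 < n := by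
  by_contra hn
  nlinarith [h.α_pos, h.n_large]

theorem sq_le : 4000 * (q ^ 2 * n) ≤ q * n := by
  have h1 := h.q_small
  have h2 : 0 ≤ q * n := (mul_pos h.q_pos h.n_pos).le
  nlinarith

theorem cube_le : 4000 * (q ^ 3 * n) ≤ q ^ 2 * n := by
  have h1 := h.q_small
  have h2 : 0 ≤ q ^ 2 * n := (mul_pos (pow_pos h.q_pos 2) h.n_pos).le
  nlinarith

theorem sixth_le : q ^ 6 * n ≤ q ^ 3 * n := by
  have h1 := h.q_small
  have h2 : q ^ 3 ≤ 1 := pow_le_one₀ h.q_pos.le (by linarith)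
  have h3 : 0 ≤ q ^ 3 * n := (mul_pos (pow_pos h.q_pos 3) h.n_pos).le
  nlinarith

theorem q_mul_le : 1000 * (q * n) ≤ γ * n := by nlinarith [h.q_le, h.n_pos]

theorem γ_mul_le : γ * n ≤ n / 4 := by nlinarith [h.γ_le, h.n_pos]

theorem large : 1000 ≤ q ^ 6 * n := by nlinarith [h.α_le, h.n_pos, h.n_large]

theorem cube_pos : 0 < q ^ 3 * n := mul_pos (pow_pos h.q_pos 3) h.n_pos

theorem α_le_one : α ≤ 1 := by
  have : q ^ 6 ≤ 1 := pow_le_one₀ h.q_pos.le (by linarith [h.q_small])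
  linarith [h.α_le, h.α_pos]

end Constants

variable {V : Type*} [Fintype V]

theorem cast_card_le_card_univ (S : Finset V) : (#S : ℝ) ≤ Fintype.card V := by
  exact_mod_cast Finset.card_le_univ S

open Classical in
/-- The vertices of `X` with few neighbours in `X`. -/
noncomputable def sparsePart (R : SimpleGraph V) (q : ℝ) (X : Finset V) : Finset V :=
  {x ∈ X | deg R x X < q ^ 3 * Fintype.card V}

theorem sparsePart_subset (R : SimpleGraph V) (q : ℝ) (X : Finset V) : sparsePart R q X ⊆ X := by
  classical
  exact Finset.filter_subset _ _

theorem deg_lt_of_mem_sparsePart {R : SimpleGraph V} {q : ℝ} {X : Finset V} {x : V}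
    (hx : x ∈ sparsePart R q X) : deg R x X < q ^ 3 * Fintype.card V := by
  classical
  exact (Finset.mem_filter.1 hx).2

/-- Every vertex of `Y` has more than half of `Y` as neighbours, with room to spare. -/
def IsDense (K : SimpleGraph V) (γ : ℝ) (Y : Finset V) : Prop :=
  ∀ y ∈ Y, #Y + γ * Fintype.card V ≤ 2 * deg K y Y

/-- `R` is negligible inside `Y`, and the at most `(1/4 - γ) n` missing vertices are fewer than half
of `Y`. -/
theorem isDense_of_subset_sparsePart {R K : SimpleGraph V} {γ q α : ℝ}
    (h : Constants γ q α (Fintype.card V))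
    (hmiss : MissAtMost R K ((1 / 4 - γ) * Fintype.card V)) {X Y : Finset V}
    (hY : Y ⊆ sparsePart R q X) (hcard : (1 / 2 - γ / 2) * Fintype.card V ≤ #Y) :
    IsDense K γ Y := by
  intro y hy
  have h1 := hmiss y Y
  have h2 := deg_mono R y (hY.trans (sparsePart_subset R q X))
  have h3 := deg_lt_of_mem_sparsePart (hY hy)
  linarith [h.cube_le, h.sq_le, h.q_mul_le, mul_pos h.q_pos h.n_pos]

/-- `S` spans an induced `(η, α)`-robust subgraph of `R`, and vertices outside `S` have fewer than
`η n` neighbours in `S`. -/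
def IsRobustHull (R : SimpleGraph V) (η α : ℝ) (S : Finset V) : Prop :=
  IsRobust η α (inducedOn R S) ∧ ∀ v ∉ S, deg R v S < η * Fintype.card V

variable [DecidableEq V]

theorem cast_card_compl (S : Finset V) : (#(Sᶜ) : ℝ) = Fintype.card V - #S := by
  rw [Finset.card_compl, Nat.cast_sub (Finset.card_le_univ S)]

theorem Constants.exists_hull {γ q α : ℝ} (h : Constants γ q α (Fintype.card V))
    {R : SimpleGraph V} {S₀ : Finset V} (hmin : ∀ v ∈ S₀, q ^ 3 * Fintype.card V ≤ deg R v S₀)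
    (hcut : ∀ X ⊆ S₀, q ^ 3 * Fintype.card V / 4 ≤ #X → q ^ 3 * Fintype.card V / 4 ≤ #(S₀ \ X) →
      q ^ 6 / 16 * (Fintype.card V : ℝ) ^ 2 ≤ pairs R X (S₀ \ X)) :
    ∃ S, S₀ ⊆ S ∧ IsRobustHull R (q ^ 3) α S := by
  have h1 := h.q_small
  have h2 : q ^ 3 ≤ 1 := pow_le_one₀ h.q_pos.le (by linarith)
  have h3 := h.α_le
  have h4 := h.α_pos
  exact exists_robust_closure (pow_pos h.q_pos 3) h.α_pos
    (by rw [← pow_mul]; norm_num; linarith) h2 (by linarith)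
    (by linarith [h.large, h.sixth_le]) hmin hcut

/-- Each vertex of `A` is `K`-adjacent to all but about `(1/4 - γ) n` of `Aᶜ`. So the set `U` of
vertices of `Aᶜ` with some `K`-degree into `A` omits at most about `(1/4 - γ) n` vertices, and `A ∪
U` has the right size and no sparse `K`-cut. -/
theorem exists_hull_of_sparse_cut {R K : SimpleGraph V} {γ q α : ℝ}
    (h : Constants γ q α (Fintype.card V))
    (hmiss : MissAtMost R K ((1 / 4 - γ) * Fintype.card V)) {A : Finset V}
    (hA1 : q ^ 2 * Fintype.card V ≤ #A) (hA2 : #A ≤ (1 / 2 + γ / 2) * Fintype.card V)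
    (hA : ∀ v ∈ A, deg R v Aᶜ < 2 * (q ^ 3 * Fintype.card V)) :
    ∃ S, IsRobustHull K (q ^ 3) α S ∧ (3 / 4 + γ / 2) * Fintype.card V ≤ #S := by
  classical
  set n : ℝ := (Fintype.card V : ℝ) with hn
  have hn0 := h.n_pos
  have hq := h.q_pos
  have c1 := h.sq_le
  have c2 := h.cube_le
  have c3 := h.q_mul_le
  have c4 := h.cube_pos
  have hqn : 0 < q * n := mul_pos hq hn0
  have hb : (#Aᶜ : ℝ) = n - #A := cast_card_compl A
  set U : Finset V := {u ∈ Aᶜ | q ^ 3 * n ≤ deg K u A} with hU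
  have hUA : U ⊆ Aᶜ := Finset.filter_subset _ _
  have hAd : ∀ v ∈ A, (#Aᶜ : ℝ) - (1 / 4 - γ) * n - 2 * (q ^ 3 * n) ≤ deg K v Aᶜ := fun v hv => by
    have := hmiss v Aᶜ
    have := hA v hv
    linarith
  have hrest : ∀ A' ⊆ A, pairs K A' (Aᶜ \ U) ≤ q ^ 3 * n ^ 2 := by
    intro A' hA'
    rw [pairs_comm]
    have h1 := pairs_le_mul K (X := Aᶜ \ U) (Y := A') (s := q ^ 3 * n) fun x hx => by
      rw [Finset.mem_sdiff] at hx
      by_contra hlt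
      exact hx.2 (Finset.mem_filter.2 ⟨hx.1, (not_le.1 hlt).le.trans (deg_mono K x hA')⟩)
    have h2 := mul_le_mul_of_nonneg_right (cast_card_le_card_univ (Aᶜ \ U)) c4.le
    linarith
  -- A large part `A'` of `A` whose neighbours in `U` are mostly in `U'` forces `U'` to be large.
  have hbigU : ∀ A' ⊆ A, ∀ U' ⊆ U, q ^ 2 * n / 2 ≤ #A' → pairs K A' (U \ U') ≤ q ^ 3 * n ^ 2 →
      (#Aᶜ : ℝ) - (1 / 4 - γ) * n - 2 * (q ^ 3 * n) - 4 * (q * n) ≤ #U' := by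
    intro A' hA' U' hU' hcard hp
    have h1 := mul_le_pairs K (X := A') fun v hv => hAd v (hA' hv)
    have h2 : pairs K A' Aᶜ ≤ pairs K A' (U' ∪ (U \ U') ∪ (Aᶜ \ U)) :=
      pairs_mono K le_rfl (by
        rw [Finset.union_sdiff_of_subset hU', Finset.union_sdiff_of_subset hUA])
    have h3 := pairs_union_right_le K A' (U' ∪ (U \ U')) (Aᶜ \ U)
    have h4 := pairs_union_right_le K A' U' (U \ U')
    have h5 := hrest A' hA'
    have h6 := pairs_le_mul K (X := A') (Y := U') fun x _ => deg_le_card K x U'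
    have h7 : q ^ 2 * n / 2 * (4 * (q * n)) ≤ #A' * (4 * (q * n)) :=
      mul_le_mul_of_nonneg_right hcard (by positivity)
    have h8 : (#A' : ℝ) * ((#Aᶜ : ℝ) - (1 / 4 - γ) * n - 2 * (q ^ 3 * n) - 4 * (q * n)) ≤
        #A' * #U' := by nlinarith
    refine le_of_mul_le_mul_left h8 ?_
    have : 0 < q ^ 2 * n / 2 := by positivity
    linarith
  have hUcard := hbigU A le_rfl U le_rfl (by linarith [mul_pos (pow_pos hq 2) hn0]) (by
    simp only [Finset.sdiff_self, pairs, deg, Finset.filter_empty, Finset.card_empty,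
      Nat.cast_zero, Finset.sum_const_zero]
    positivity)
  have hdisAU : Disjoint A U := Finset.disjoint_left.2 fun x hx hxU =>
    (Finset.mem_compl.1 (hUA hxU)) hx
  -- Two losses of `(1/4 - γ) n` from `Aᶜ` still leave `γ n`, because `#A` is at most `(1/2 + γ/2)
  -- n`.
  have hdegU : ∀ v ∈ A, ∀ U' ⊆ U,
      (#Aᶜ : ℝ) - (1 / 4 - γ) * n - 2 * (q ^ 3 * n) - 4 * (q * n) ≤ #U' →
      γ * n ≤ deg K v U' := by
    intro v hv U' hU' hc
    have h1 := hAd v hv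
    have h2 := deg_le_add K v (show Aᶜ ⊆ U' ∪ (Aᶜ \ U') by
      rw [Finset.union_sdiff_of_subset (hU'.trans hUA)])
    have h3 := cast_card_sdiff (hU'.trans hUA)
    linarith
  -- If few `K`-edges leave `X`, then `A \ X`, which is at least half of `A`, sees little of `U ∩
  -- X`, and `hbigU` makes `U \ X` large. Then either `A ∩ X` sends many edges to `U \ X`, or `A ∩
  -- X` is tiny and the vertices of `U ∩ X` send theirs to `A \ X`.
  have hcut1 : ∀ X ⊆ A ∪ U, #(A ∩ X) ≤ #(A \ X) → q ^ 3 * n / 4 ≤ #X →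
      q ^ 6 / 16 * n ^ 2 ≤ pairs K X ((A ∪ U) \ X) := by
    intro X hX hle hXc
    by_contra hlt
    rw [not_le] at hlt
    have hAc : (#(A \ X) : ℝ) + #(A ∩ X) = #A := by
      exact_mod_cast Finset.card_sdiff_add_card_inter A X
    have hle' : (#(A ∩ X) : ℝ) ≤ #(A \ X) := by exact_mod_cast hle
    have hq6 : q ^ 6 / 16 * n ^ 2 ≤ q ^ 3 * n ^ 2 := by
      have : q ^ 3 ≤ 1 := pow_le_one₀ hq.le (by linarith [h.q_small])
      have : 0 ≤ q ^ 3 * n ^ 2 := by positivity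
      nlinarith
    have h1 := hbigU (A \ X) Finset.sdiff_subset (U \ X) Finset.sdiff_subset (by linarith) (by
      have := pairs_mono K (X := U \ (U \ X)) (X' := X) (Y := A \ X) (Y' := (A ∪ U) \ X)
        (fun x hx => by
          simp only [Finset.mem_sdiff] at hx
          tauto) (Finset.sdiff_subset_sdiff Finset.subset_union_left le_rfl)
      rw [pairs_comm]
      linarith)
    rcases le_or_gt (q ^ 3 * n / 8) (#(A ∩ X) : ℝ) with h2 | h2
    · have h3 := mul_le_pairs K (X := A ∩ X) fun v hv => hdegU v (Finset.mem_inter.1 hv).1 (U \ X)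
        Finset.sdiff_subset h1
      have h4 := pairs_mono K (X := A ∩ X) (X' := X) (Y := U \ X) (Y' := (A ∪ U) \ X)
        Finset.inter_subset_right (Finset.sdiff_subset_sdiff Finset.subset_union_right le_rfl)
      have h5 : q ^ 3 * n / 8 * (q ^ 3 * n) ≤ #(A ∩ X) * (γ * n) :=
        mul_le_mul h2 (by linarith) c4.le (by positivity)
      have h6 : q ^ 3 * n / 8 * (q ^ 3 * n) = q ^ 6 / 8 * n ^ 2 := by ring
      have h7 : 0 < q ^ 6 * n ^ 2 := by positivity
      linarith
    · have h3 : (#X : ℝ) ≤ #(A ∩ X) + #(U ∩ X) := card_le_add_of_subset fun x hx => by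
        have := hX hx
        simp only [Finset.mem_union, Finset.mem_inter] at this ⊢
        tauto
      have h4 := mul_le_pairs K (X := U ∩ X) (Y := A \ X) (s := q ^ 3 * n / 2) fun u hu => by
        have h5 := (Finset.mem_filter.1 (Finset.mem_inter.1 hu).1).2
        have h6 := deg_le_add K u (show A ⊆ (A \ X) ∪ (A ∩ X) by
          rw [Finset.sdiff_union_inter])
        linarith
      have h5 := pairs_mono K (X := U ∩ X) (X' := X) (Y := A \ X) (Y' := (A ∪ U) \ X)
        Finset.inter_subset_right (Finset.sdiff_subset_sdiff Finset.subset_union_left le_rfl)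
      have h6 : q ^ 3 * n / 8 * (q ^ 3 * n / 2) ≤ #(U ∩ X) * (q ^ 3 * n / 2) :=
        mul_le_mul_of_nonneg_right (by linarith) (by positivity)
      nlinarith
  obtain ⟨S, hS, hhull⟩ := h.exists_hull (R := K) (S₀ := A ∪ U) (by
    intro v hv
    rcases Finset.mem_union.1 hv with hv | hv
    · have h1 := hdegU v hv U le_rfl hUcard
      have h2 := deg_mono K v (Finset.subset_union_right (s₁ := A) (s₂ := U))
      linarith
    · exact (Finset.mem_filter.1 hv).2.trans (deg_mono K v Finset.subset_union_left)) (by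
    intro X hX h1 h2
    rcases le_total #(A ∩ X) #(A \ X) with h3 | h3
    · exact hcut1 X hX h3 h1
    · rw [pairs_comm]
      have e1 : A ∩ ((A ∪ U) \ X) = A \ X := by
        ext x; simp only [Finset.mem_inter, Finset.mem_union, Finset.mem_sdiff]; tauto
      have e2 : A \ ((A ∪ U) \ X) = A ∩ X := by
        ext x; simp only [Finset.mem_inter, Finset.mem_union, Finset.mem_sdiff]; tauto
      have := hcut1 ((A ∪ U) \ X) Finset.sdiff_subset (by rw [e1, e2]; exact h3) h2
      rwa [Finset.sdiff_sdiff_eq_self hX] at this)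
  refine ⟨S, hhull, ?_⟩
  have h1 : (#(A ∪ U) : ℝ) ≤ #S := by exact_mod_cast Finset.card_le_card hS
  rw [Finset.card_union_of_disjoint hdisAU] at h1
  push_cast at h1
  linarith

/-- Either one colour has an almost spanning robust subgraph, or the other colour has a robust
subgraph on more than three quarters of the vertices. -/
theorem exists_hull_dichotomy {R K : SimpleGraph V} {γ q α : ℝ}
    (h : Constants γ q α (Fintype.card V))
    (hmiss : MissAtMost R K ((1 / 4 - γ) * Fintype.card V)) :
    (∃ S, IsRobustHull R (q ^ 3) α S ∧ (1 - q ^ 2) * Fintype.card V ≤ #S) ∨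
    ∃ S, IsRobustHull K (q ^ 3) α S ∧ (3 / 4 + γ / 2) * Fintype.card V ≤ #S := by
  classical
  set n : ℝ := (Fintype.card V : ℝ) with hn
  have hn0 := h.n_pos
  have hq := h.q_pos
  have c1 := h.sq_le
  have c2 := h.cube_le
  have c3 := h.q_mul_le
  have c4 := h.cube_pos
  have c5 := h.large
  have c6 := h.sixth_le
  have c7 := h.γ_mul_le
  obtain ⟨A, hA⟩ := (Set.toFinite {A : Finset V | (∀ v ∈ A, deg R v Aᶜ < 2 * (q ^ 3 * n)) ∧
    #A ≤ (1 / 2 + γ / 2) * n}).exists_maximal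
    ⟨∅, by simp, by
      have : 0 < γ * n := by linarith
      simp only [Finset.card_empty, Nat.cast_zero]; linarith⟩
  obtain ⟨hA1, hA2⟩ := hA.prop
  rcases le_or_gt (q ^ 2 * n) (#A : ℝ) with hAc | hAc
  · exact Or.inr (exists_hull_of_sparse_cut h hmiss hAc hA2 hA1)
  left
  have hb : (#Aᶜ : ℝ) = n - #A := cast_card_compl A
  -- The smaller side of a sparse cut, without its few vertices `D` of large cross degree, could be
  -- added to `A`. The slack in `2 * (q ^ 3 * n)` pays for the edges to `D`, and `#A < q ^ 2 * n`
  -- keeps the union below the size bound.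
  have hcut1 : ∀ X ⊆ Aᶜ, #X ≤ #(Aᶜ \ X) → q ^ 3 * n / 4 ≤ #X →
      q ^ 6 / 16 * n ^ 2 ≤ pairs R X (Aᶜ \ X) := by
    intro X hX hle hXc
    by_contra hlt
    rw [not_le] at hlt
    set D : Finset V := {x ∈ X | q ^ 3 * n ≤ deg R x (Aᶜ \ X)} with hD
    have hDX : D ⊆ X := Finset.filter_subset _ _
    have hDc : (#D : ℝ) < q ^ 3 * n / 8 := by
      have h1 := mul_le_pairs R (X := D) (Y := Aᶜ \ X) fun x hx => (Finset.mem_filter.1 hx).2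
      have h2 := pairs_mono R hDX (le_refl (Aᶜ \ X))
      have h3 : #D * (q ^ 3 * n) < q ^ 3 * n / 8 * (q ^ 3 * n) := by
        have : 0 < q ^ 6 * n ^ 2 := by positivity
        nlinarith
      exact lt_of_mul_lt_mul_right h3 c4.le
    have hsub : A ⊆ A ∪ (X \ D) := Finset.subset_union_left
    have hXAc : (#X : ℝ) + #X ≤ n - #A := by
      have h1 := cast_card_sdiff hX
      have h2 : (#X : ℝ) ≤ #(Aᶜ \ X) := by exact_mod_cast hle
      linarith
    have hP := hA.le_of_ge (y := A ∪ (X \ D)) ⟨by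
      intro v hv
      rcases Finset.mem_union.1 hv with hv | hv
      · exact (deg_mono R v (Finset.compl_subset_compl.2 hsub)).trans_lt (hA1 v hv)
      · have h1 := deg_le_add R v (show (A ∪ (X \ D))ᶜ ⊆ (Aᶜ \ X) ∪ D from fun x hx => by
          simp only [Finset.mem_compl, Finset.mem_union, Finset.mem_sdiff] at hx ⊢
          tauto)
        rw [Finset.mem_sdiff] at hv
        have h2 : deg R v (Aᶜ \ X) < q ^ 3 * n := by
          by_contra hge
          exact hv.2 (Finset.mem_filter.2 ⟨hv.1, not_lt.1 hge⟩)
        linarith, by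
      have h1 : (#(A ∪ (X \ D)) : ℝ) ≤ #A + #X :=
        card_le_add_of_subset (Finset.union_subset_union_right Finset.sdiff_subset)
      linarith⟩ hsub
    have h1 : X ⊆ D := fun x hx => by
      by_contra hxD
      exact Finset.mem_compl.1 (hX hx)
        (hP (Finset.mem_union_right _ (Finset.mem_sdiff.2 ⟨hx, hxD⟩)))
    have h2 : (#X : ℝ) ≤ #D := by exact_mod_cast Finset.card_le_card h1
    linarith
  obtain ⟨S, hS, hhull⟩ := h.exists_hull (R := R) (S₀ := Aᶜ) (by
    intro v hv
    by_contra hlt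
    rw [not_le] at hlt
    have hsub := Finset.subset_insert v A
    have hmono := fun u => deg_mono R u (Finset.compl_subset_compl.2 hsub)
    refine Finset.mem_compl.1 hv (hA.le_of_ge (y := insert v A) ⟨?_, ?_⟩ hsub
      (Finset.mem_insert_self v A))
    · intro u hu
      rcases Finset.mem_insert.1 hu with rfl | hu
      · exact (hmono u).trans_lt (by linarith)
      · exact (hmono u).trans_lt (hA1 u hu)
    · rw [Finset.card_insert_of_notMem (Finset.mem_compl.1 hv)]
      push_cast
      linarith) (by
    intro X hX h1 h2
    rcases le_total #X #(Aᶜ \ X) with h3 | h3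
    · exact hcut1 X hX h3 h1
    · rw [pairs_comm]
      have := hcut1 (Aᶜ \ X) Finset.sdiff_subset (by rwa [Finset.sdiff_sdiff_eq_self hX]) h2
      rwa [Finset.sdiff_sdiff_eq_self hX] at this)
  refine ⟨S, hhull, ?_⟩
  have h1 : (#Aᶜ : ℝ) ≤ #S := by exact_mod_cast Finset.card_le_card hS
  linarith

theorem IsDense.exists_hull {K : SimpleGraph V} {γ q α : ℝ}
    (h : Constants γ q α (Fintype.card V)) {Y : Finset V} (hY : IsDense K γ Y) :
    ∃ S, Y ⊆ S ∧ IsRobustHull K (q ^ 3) α S := by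
  set n : ℝ := (Fintype.card V : ℝ) with hn
  have hn0 := h.n_pos
  have hq := h.q_pos
  have c1 := h.sq_le
  have c2 := h.cube_le
  have c3 := h.q_mul_le
  have c4 := h.cube_pos
  have hY0 : (0 : ℝ) ≤ #Y := Nat.cast_nonneg _
  have hcut1 : ∀ X ⊆ Y, #X ≤ #(Y \ X) → q ^ 3 * n / 4 ≤ #X →
      q ^ 6 / 16 * n ^ 2 ≤ pairs K X (Y \ X) := by
    intro X hX hle hXc
    have h1 := cast_card_sdiff hX
    have h2 : (#X : ℝ) ≤ #(Y \ X) := by exact_mod_cast hle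
    have h3 := mul_le_pairs K (X := X) (Y := Y \ X) (s := q ^ 3 * n) fun x hx => by
      have h4 := hY x (hX hx)
      have h5 := deg_le_add K x (show Y ⊆ (Y \ X) ∪ X by rw [Finset.sdiff_union_of_subset hX])
      linarith
    have h6 : q ^ 3 * n / 4 * (q ^ 3 * n) ≤ #X * (q ^ 3 * n) :=
      mul_le_mul_of_nonneg_right hXc c4.le
    have : 0 < q ^ 6 * n ^ 2 := by positivity
    nlinarith
  refine h.exists_hull (fun v hv => ?_) fun X hX h1 h2 => ?_
  · have := hY v hv
    linarith
  · rcases le_total #X #(Y \ X) with h3 | h3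
    · exact hcut1 X hX h3 h1
    · rw [pairs_comm]
      have := hcut1 (Y \ X) Finset.sdiff_subset (by rwa [Finset.sdiff_sdiff_eq_self hX]) h2
      rwa [Finset.sdiff_sdiff_eq_self hX] at this

/-- One side of any bipartition contains at least half of `Y`, and there each vertex of `Y` keeps `γ
n / 2` neighbours. -/
theorem IsDense.not_isNearBipartite {K : SimpleGraph V} {γ q α : ℝ}
    (h : Constants γ q α (Fintype.card V)) {Y S : Finset V} (hY : IsDense K γ Y) (hYS : Y ⊆ S)
    (hcard : (Fintype.card V : ℝ) / 4 ≤ #Y) : ¬ IsNearBipartite (α ^ 4) (inducedOn K S) := by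
  classical
  set n : ℝ := (Fintype.card V : ℝ) with hn
  have hn0 := h.n_pos
  have key : ∀ T ⊆ S, #(Y \ T) ≤ #(Y ∩ T) →
      ¬ (edgeCount (inducedOn K S) T T : ℝ) < α ^ 4 * (#S : ℝ) ^ 2 := by
    intro T hT hle hlt
    have h1 : (#(Y \ T) : ℝ) + #(Y ∩ T) = #Y := by
      exact_mod_cast Finset.card_sdiff_add_card_inter Y T
    have h2 : (#(Y \ T) : ℝ) ≤ #(Y ∩ T) := by exact_mod_cast hle
    have h3 := mul_le_pairs K (X := Y ∩ T) (Y := Y ∩ T) (s := γ * n / 2) fun y hy => by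
      have h4 := hY y (Finset.mem_inter.1 hy).1
      have h5 := deg_le_add K y (show Y ⊆ (Y ∩ T) ∪ (Y \ T) by
        rw [Finset.union_comm, Finset.sdiff_union_inter])
      linarith
    have h4 := pairs_mono K (Finset.inter_subset_right (s₁ := Y) (s₂ := T))
      (Finset.inter_subset_right (s₁ := Y) (s₂ := T))
    have h5 := pairs_le_edgeCount (inducedOn K S) T T
    rw [pairs_inducedOn hT hT] at h5
    have hγn : 0 ≤ γ * n / 2 := by
      linarith [h.q_mul_le, mul_pos h.q_pos hn0]
    have h6 : n / 8 * (γ * n / 2) ≤ #(Y ∩ T) * (γ * n / 2) :=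
      mul_le_mul_of_nonneg_right (by linarith) hγn
    have h7 : (#S : ℝ) ^ 2 ≤ n ^ 2 := by
      gcongr
      exact cast_card_le_card_univ S
    have h8 : α ^ 4 * (#S : ℝ) ^ 2 ≤ α * n ^ 2 :=
      mul_le_mul (pow_le_of_le_one h.α_pos.le h.α_le_one (by norm_num)) h7 (by positivity)
        h.α_pos.le
    have h9 : 1000 * α ≤ γ := by
      have : q ^ 6 ≤ q := pow_le_of_le_one h.q_pos.le (by linarith [h.q_small]) (by norm_num)
      linarith [h.α_le, h.q_le, h.q_pos]
    have h10 := mul_le_mul_of_nonneg_right h9 (sq_nonneg n)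
    have : 0 < α * n ^ 2 := mul_pos h.α_pos (by positivity)
    nlinarith
  rintro ⟨Z', hZ', h1, h2⟩
  obtain ⟨Z, rfl⟩ : ∃ Z : Finset V, (Z : Set V) = Z' := ⟨Z'.toFinset, by simp⟩
  have hverts : (inducedOn K S).verts = (S : Set V) := rfl
  rw [hverts, Finset.coe_subset] at hZ'
  rw [hverts, Set.ncard_coe_finset] at h1 h2
  rw [← Finset.coe_sdiff] at h2
  rcases le_total #(Y \ Z) #(Y ∩ Z) with h3 | h3
  · exact key Z hZ' h3 h1
  · refine key (S \ Z) Finset.sdiff_subset ?_ h2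
    have e1 : Y \ (S \ Z) = Y ∩ Z := by
      ext x
      have := @hYS x
      simp only [Finset.mem_sdiff, Finset.mem_inter]
      tauto
    have e2 : Y ∩ (S \ Z) = Y \ Z := by
      ext x
      have := @hYS x
      simp only [Finset.mem_sdiff, Finset.mem_inter]
      tauto
    rw [e1, e2]
    exact h3

theorem card_sdiff_sparsePart_le {R : SimpleGraph V} {γ q α : ℝ}
    (h : Constants γ q α (Fintype.card V)) {X : Finset V}
    (hX : pairs R X X ≤ α ^ 2 * (Fintype.card V : ℝ) ^ 2) :
    (#(X \ sparsePart R q X) : ℝ) ≤ q ^ 3 * Fintype.card V := by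
  classical
  have h1 := mul_le_pairs R (X := X \ sparsePart R q X) (Y := X) (s := q ^ 3 * Fintype.card V)
    fun x hx => by
      rw [Finset.mem_sdiff] at hx
      by_contra hlt
      exact hx.2 (Finset.mem_filter.2 ⟨hx.1, not_le.1 hlt⟩)
  have h2 := pairs_mono R (Finset.sdiff_subset (s := X) (t := sparsePart R q X)) (le_refl X)
  have h3 : α ^ 2 ≤ q ^ 6 := by
    nlinarith [h.α_le, h.α_le_one, h.α_pos]
  have h4 := mul_le_mul_of_nonneg_right h3 (sq_nonneg (Fintype.card V : ℝ))
  refine le_of_mul_le_mul_right ?_ h.cube_pos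
  nlinarith

/-- What a nice partition requires of a near-bipartite member `S` of colour `R`, when `T` is the
member of the other colour `K`. -/
def HasNiceBipartition (R K : SimpleGraph V) (η α : ℝ) (S T : Finset V) : Prop :=
  ∃ X Y : Finset V, IsBipartition (η / 2) (α ^ 2) (inducedOn R S) X Y ∧ #X ≤ #Y ∧
    IsRobust (η / 2) (α / 2) (betweenSubgraph (inducedOn R S) X Y) ∧
    ¬ IsNearBipartite (α ^ 4) (inducedOn K T) ∧ (Fintype.card V : ℝ) / 4 ≤ #(T ∩ Y)

/-- The sparse part `Y'` of the larger class is `K`-dense and generates the hull `T`. A large `T`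
completes the nice partition; a `T` of size about `n / 2` is essentially `Y'`, and the vertices
outside it have almost no `K`-edges to `Y'`. -/
theorem cyclePartition_or_of_large_nearBipartite {R K : SimpleGraph V} {γ q α : ℝ}
    (h : Constants γ q α (Fintype.card V))
    (hmiss : MissAtMost R K ((1 / 4 - γ) * Fintype.card V)) {S : Finset V}
    (hS : IsRobustHull R (q ^ 3) α S) (hcard : (1 - q ^ 2) * Fintype.card V ≤ #S)
    (hnb : IsNearBipartite (α ^ 4) (inducedOn R S)) :
    (∃ P : Set V, IsCycleSet R P ∧ IsCycleSet K Pᶜ) ∨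
    ∃ T, IsRobustHull K (q ^ 3) α T ∧ (1 / 2 + (q ^ 3) ^ 2) * Fintype.card V ≤ #T ∧
      (∀ v, v ∈ S ∨ v ∈ T) ∧ ¬ IsNearBipartite (α ^ 4) (inducedOn K T) ∧
      HasNiceBipartition R K (q ^ 3) α S T := by
  classical
  set n : ℝ := (Fintype.card V : ℝ) with hn
  have hn0 := h.n_pos
  have hq := h.q_pos
  have c1 := h.sq_le
  have c2 := h.cube_le
  have c3 := h.q_mul_le
  have c4 := h.cube_pos
  have c5 := h.large
  have c6 := h.sixth_le
  have c7 := h.γ_mul_le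
  have hq1 : q ^ 3 ≤ 1 := pow_le_one₀ hq.le (by linarith [h.q_small])
  obtain ⟨X, Y, hXY, hdis, hle, hbip, hbrob, hpX, hpY⟩ := exists_robust_bipartition
    (pow_pos hq 3) hq1 h.α_pos (by
      have := h.α_le
      have := h.α_pos
      rw [← pow_mul]; norm_num; linarith) hS.1 hnb
  have dX := card_sdiff_sparsePart_le h hpX
  have dY := card_sdiff_sparsePart_le h hpY
  set X' := sparsePart R q X with hX'
  set Y' := sparsePart R q Y with hY'
  have hX'X : X' ⊆ X := sparsePart_subset R q X
  have hY'Y : Y' ⊆ Y := sparsePart_subset R q Y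
  rw [cast_card_sdiff hX'X] at dX
  rw [cast_card_sdiff hY'Y] at dY
  have hsum : (#X + #Y : ℝ) = #S := by
    rw [← hXY, Finset.card_union_of_disjoint hdis]; push_cast; rfl
  have hle' : (#X : ℝ) ≤ #Y := by exact_mod_cast hle
  have hYc : n / 2 - q ^ 2 * n / 2 ≤ #Y := by linarith
  have hdense : IsDense K γ Y' := isDense_of_subset_sparsePart h hmiss (X := Y) le_rfl (by
    rw [← hn]; linarith)
  obtain ⟨T, hY'T, hT⟩ := hdense.exists_hull h
  have hYS : Y' ⊆ S := hY'Y.trans (hXY ▸ Finset.subset_union_right)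
  rcases le_or_gt ((1 / 2 + (q ^ 3) ^ 2) * n) (#T : ℝ) with hTc | hTc
  · right
    have hTn := hdense.not_isNearBipartite h hY'T (by rw [← hn]; linarith)
    refine ⟨T, hT, hTc, fun v => ?_, hTn, X, Y, hbip, hle, hbrob, hTn, ?_⟩
    · by_contra hv
      rw [not_or] at hv
      have h1 := (deg_mono R v hYS).trans_lt (hS.2 v hv.1)
      have h2 := (deg_mono K v hY'T).trans_lt (hT.2 v hv.2)
      have h3 := hmiss v Y'
      linarith
    · have h1 : (#Y' : ℝ) ≤ #(T ∩ Y) := by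
        exact_mod_cast Finset.card_le_card (Finset.subset_inter hY'T hY'Y)
      linarith
  · left
    have hq6 : (q ^ 3) ^ 2 * n = q ^ 6 * n := by ring
    have h0 : (#Y' : ℝ) ≤ #T := by exact_mod_cast Finset.card_le_card hY'T
    have h1 : (#(T \ Y') : ℝ) = #T - #Y' := cast_card_sdiff hY'T
    have h2 : (#X' : ℝ) ≤ #(X' \ T) + #(T \ Y') := card_le_add_of_subset fun x hx => by
      have hxY : x ∉ Y' := fun hxY => Finset.disjoint_left.1 hdis (hX'X hx) (hY'Y hxY)
      simp only [Finset.mem_union, Finset.mem_sdiff]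
      tauto
    -- The upper bound on `#T` also bounds `#Y`, so `X' \ T` too has nearly `n / 2` vertices. The
    -- `K`-degree bound `q ^ 3 * n` from the hull lies well below `(10 * q) ^ 2 * n`.
    refine cyclePartition_of_sparse_pair (γ := γ) (τ := 10 * q) (A₀ := Y') (B₀ := X' \ T) hn
      (by positivity) (by linarith [h.q_le]) h.γ_le (by linarith) hmiss ?_ ?_ ?_ ?_ ?_ ?_
    · exact Finset.disjoint_left.2 fun x hx hx' => (Finset.mem_sdiff.1 hx').2 (hY'T hx)
    · linarith
    · linarith
    · intro a ha
      have := deg_lt_of_mem_sparsePart ha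
      have := deg_mono R a hY'Y
      linarith
    · intro b hb
      have := deg_lt_of_mem_sparsePart (Finset.mem_sdiff.1 hb).1
      have := deg_mono R b (Finset.sdiff_subset.trans hX'X : X' \ T ⊆ X)
      linarith
    · intro b hb
      have := hT.2 b (Finset.mem_sdiff.1 hb).2
      have := deg_mono K b hY'T
      have : 0 ≤ q ^ 2 * n := by positivity
      nlinarith

/-- The hulls meet in at least `(1/2 + γ) n` vertices. A vertex outside both would see almost none
of them in either colour, but it can miss only `(1/4 - γ) n`. -/
theorem mem_or_mem_of_large_hulls {R K : SimpleGraph V} {γ q α : ℝ}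
    (h : Constants γ q α (Fintype.card V))
    (hmiss : MissAtMost R K ((1 / 4 - γ) * Fintype.card V)) {S T : Finset V}
    (hS : IsRobustHull R (q ^ 3) α S) (hT : IsRobustHull K (q ^ 3) α T)
    (hSc : (3 / 4 + γ / 2) * Fintype.card V ≤ #S) (hTc : (3 / 4 + γ / 2) * Fintype.card V ≤ #T)
    (v : V) : v ∈ S ∨ v ∈ T := by
  by_contra hv
  rw [not_or] at hv
  have h1 := (deg_mono R v (Finset.inter_subset_left : S ∩ T ⊆ S)).trans_lt (hS.2 v hv.1)
  have h2 := (deg_mono K v (Finset.inter_subset_right : S ∩ T ⊆ T)).trans_lt (hT.2 v hv.2)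
  have h3 := hmiss v (S ∩ T)
  have h4 : (#(S ∪ T) + #(S ∩ T) : ℝ) = #S + #T := by
    exact_mod_cast Finset.card_union_add_card_inter S T
  have h5 := cast_card_le_card_univ (S ∪ T)
  linarith [h.cube_le, h.sq_le, h.q_mul_le, mul_pos h.q_pos h.n_pos]

/-- More than `q ^ 2 * n` vertices lie outside `T`, so one of them, `v`, is typical in `S`. It has
few `K`-neighbours in `T` and few `R`-neighbours in its own class or outside `S`; so `T` lies mostly
in the opposite class, up to the vertices `v` misses. -/
theorem hasNiceBipartition_of_large_hulls {R K : SimpleGraph V} {γ q α : ℝ}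
    (h : Constants γ q α (Fintype.card V))
    (hmiss : MissAtMost R K ((1 / 4 - γ) * Fintype.card V)) {S T : Finset V}
    (hS : IsRobustHull R (q ^ 3) α S) (hT : IsRobustHull K (q ^ 3) α T)
    (hSc : (3 / 4 + γ / 2) * Fintype.card V ≤ #S) (hTc : (3 / 4 + γ / 2) * Fintype.card V ≤ #T)
    (hTlt : #T < (1 - q ^ 2) * Fintype.card V)
    (hnb : IsNearBipartite (α ^ 4) (inducedOn R S)) :
    HasNiceBipartition R K (q ^ 3) α S T := by
  classical
  have hcov := mem_or_mem_of_large_hulls h hmiss hS hT hSc hTc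
  set n : ℝ := (Fintype.card V : ℝ) with hn
  have hn0 := h.n_pos
  have hq := h.q_pos
  have c1 := h.sq_le
  have c2 := h.cube_le
  have c3 := h.q_mul_le
  have c4 := h.cube_pos
  have c7 := h.γ_mul_le
  have hqn : 0 < q * n := mul_pos hq hn0
  have hq1 : q ^ 3 ≤ 1 := pow_le_one₀ hq.le (by linarith [h.q_small])
  obtain ⟨X, Y, hXY, hdis, hle, hbip, hbrob, hpX, hpY⟩ := exists_robust_bipartition
    (pow_pos hq 3) hq1 h.α_pos (by
      have := h.α_le
      have := h.α_pos
      rw [← pow_mul]; norm_num; linarith) hS.1 hnb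
  have dX := card_sdiff_sparsePart_le h hpX
  have dY := card_sdiff_sparsePart_le h hpY
  have hle' : (#X : ℝ) ≤ #Y := by exact_mod_cast hle
  set E : Finset V := {v ∈ S | q * n ≤ deg R v Sᶜ} with hE
  have hEc : (#E : ℝ) ≤ q ^ 2 * n / 4 := by
    have h1 := card_mul_le_of_deg (K := R) (A := E) (B := Sᶜ) (s := q * n) (t := q ^ 3 * n)
      (fun a ha => (Finset.mem_filter.1 ha).2) (fun b hb =>
        (deg_mono R b (Finset.filter_subset _ S)).trans (hS.2 b (Finset.mem_compl.1 hb)).le)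
    have h2 := cast_card_compl S
    have h3 : (#Sᶜ : ℝ) * (q ^ 3 * n) ≤ n / 4 * (q ^ 3 * n) :=
      mul_le_mul_of_nonneg_right (by linarith) c4.le
    refine le_of_mul_le_mul_right ?_ hqn
    nlinarith
  -- A vertex outside `T` avoiding all exceptional sets.
  obtain ⟨v, hvT, hvE, hv⟩ : ∃ v, v ∉ T ∧ v ∉ E ∧
      (v ∈ sparsePart R q X ∨ v ∈ sparsePart R q Y) := by
    by_contra hno
    push Not at hno
    have h1 : Tᶜ ⊆ E ∪ ((X \ sparsePart R q X) ∪ (Y \ sparsePart R q Y)) := fun v hv => by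
      have hvT := Finset.mem_compl.1 hv
      have h2 := hno v hvT
      have h3 : v ∈ X ∪ Y := hXY ▸ (hcov v).resolve_right hvT
      simp only [Finset.mem_union, Finset.mem_sdiff] at h3 ⊢
      tauto
    have h2 := card_le_add_of_subset h1
    have h3 := card_le_add_of_subset (le_refl ((X \ sparsePart R q X) ∪ (Y \ sparsePart R q Y)))
    have h4 := cast_card_compl T
    linarith [mul_pos (pow_pos hq 2) hn0]
  have hvT' := hT.2 v hvT
  -- If `v` has few `R`-neighbours in `Z`, then `T` has a large part in `S \ Z`.
  have key : ∀ Z Z' : Finset V, Z ∪ Z' = S → v ∈ S → deg R v Z < q ^ 3 * n →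
      n / 2 + γ * n ≤ #(T ∩ Z') := by
    intro Z Z' hZ hvS hd
    have h1 := hmiss v (T \ Z')
    have h2 := deg_mono K v (Finset.sdiff_subset : T \ Z' ⊆ T)
    have h3 := deg_le_deg_add R v (show T \ Z' ⊆ Z ∪ Sᶜ from fun x hx => by
      rw [← hZ]
      simp only [Finset.mem_sdiff, Finset.mem_union, Finset.mem_compl] at hx ⊢
      tauto)
    have h4 : deg R v Sᶜ < q * n := by
      by_contra hge
      exact hvE (Finset.mem_filter.2 ⟨hvS, not_lt.1 hge⟩)
    have h5 : (#(T \ Z') : ℝ) + #(T ∩ Z') = #T := by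
      exact_mod_cast Finset.card_sdiff_add_card_inter T Z'
    linarith
  -- If `v` were in `Y`, more than half of all vertices would lie in `X`, the smaller class.
  have hTY : n / 2 + γ * n ≤ #(T ∩ Y) := by
    rcases hv with hv | hv
    · exact key X Y hXY (hXY ▸ Finset.mem_union_left _ (sparsePart_subset R q X hv))
        (deg_lt_of_mem_sparsePart hv)
    · have h1 := key Y X (by rw [Finset.union_comm, hXY])
        (hXY ▸ Finset.mem_union_right _ (sparsePart_subset R q Y hv))
        (deg_lt_of_mem_sparsePart hv)
      have h2 : (#(T ∩ X) : ℝ) ≤ #X := by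
        exact_mod_cast Finset.card_le_card Finset.inter_subset_right
      have h3 := cast_card_le_card_univ (X ∪ Y)
      rw [Finset.card_union_of_disjoint hdis] at h3
      push_cast at h3
      linarith
  have hcore : (#(T ∩ Y) : ℝ) ≤ #(T ∩ sparsePart R q Y) + #(Y \ sparsePart R q Y) :=
    card_le_add_of_subset fun x hx => by
      simp only [Finset.mem_union, Finset.mem_sdiff, Finset.mem_inter] at hx ⊢
      tauto
  have hdense : IsDense K γ (T ∩ sparsePart R q Y) :=
    isDense_of_subset_sparsePart h hmiss Finset.inter_subset_right (by rw [← hn]; linarith)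
  exact ⟨X, Y, hbip, hle, hbrob, hdense.not_isNearBipartite h Finset.inter_subset_left
    (by rw [← hn]; linarith), by linarith⟩

end Structure

/-! ### Translation to edge colourings, and the final assembly. -/

section Main

variable {V : Type*} {G : SimpleGraph V}

theorem graphDegIn_eq_deg (R : SimpleGraph V) (v : V) (S : Finset V) :
    (graphDegIn R v S : ℝ) = deg R v S := by
  classical
  unfold graphDegIn deg
  rw [← Set.ncard_coe_finset]
  congr 2
  ext w
  simp [and_comm]

theorem hasCyclePartition_of {C : G.EdgeLabeling (Fin 2)} {i j : Fin 2} (hij : i ≠ j)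
    (h : ∃ P : Set V, IsCycleSet (C.labelGraph i) P ∧ IsCycleSet (C.labelGraph j) Pᶜ) :
    HasCyclePartition C := by
  obtain ⟨P, h1, h2⟩ := h
  obtain ⟨rfl, rfl⟩ | ⟨rfl, rfl⟩ : (i = 0 ∧ j = 1) ∨ (i = 1 ∧ j = 0) := by omega
  · exact ⟨P, h1, h2⟩
  · exact ⟨Pᶜ, h2, by rwa [compl_compl]⟩

theorem ncard_verts_inducedOn (R : SimpleGraph V) (S : Finset V) :
    (inducedOn R S).verts.ncard = #S := Set.ncard_coe_finset S

variable [Fintype V]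

theorem missAtMost_labelGraph [DecidableRel G.Adj] (C : G.EdgeLabeling (Fin 2)) {γ : ℝ}
    (hδ : (3 / 4 + γ) * (Fintype.card V : ℝ) ≤ (G.minDegree : ℝ)) {i j : Fin 2} (hij : i ≠ j) :
    MissAtMost (C.labelGraph i) (C.labelGraph j) ((1 / 4 - γ) * Fintype.card V) := by
  classical
  intro v S
  have hk : ∀ k : Fin 2, k = i ∨ k = j := fun k => by omega
  have h1 : #S ≤ #{x ∈ S | (C.labelGraph i).Adj v x} + #{x ∈ S | (C.labelGraph j).Adj v x} +
      #(univ \ G.neighborFinset v) := by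
    refine (Finset.card_le_card fun x hx => ?_).trans ((Finset.card_union_le _ _).trans
      (Nat.add_le_add_right (Finset.card_union_le _ _) _))
    simp only [Finset.mem_union, Finset.mem_filter, Finset.mem_sdiff, Finset.mem_univ, true_and,
      SimpleGraph.mem_neighborFinset, SimpleGraph.EdgeLabeling.labelGraph_adj]
    by_cases hadj : G.Adj v x
    · rcases hk (C ⟨s(v, x), hadj⟩) with h | h
      · exact Or.inl (Or.inl ⟨hx, hadj, h⟩)
      · exact Or.inl (Or.inr ⟨hx, hadj, h⟩)
    · exact Or.inr hadj
  have h2 : (#(univ \ G.neighborFinset v) : ℝ) = Fintype.card V - G.degree v := by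
    rw [cast_card_sdiff (Finset.subset_univ _), Finset.card_univ,
      SimpleGraph.card_neighborFinset_eq_degree]
  have h3 : (G.minDegree : ℝ) ≤ G.degree v := by exact_mod_cast G.minDegree_le_degree v
  have h4 : (#S : ℝ) ≤ #{x ∈ S | (C.labelGraph i).Adj v x} +
      #{x ∈ S | (C.labelGraph j).Adj v x} + #(univ \ G.neighborFinset v) := by exact_mod_cast h1
  unfold deg
  have h5 : (#S : ℝ) ≤ #{x ∈ S | (C.labelGraph i).Adj v x} +
      #{x ∈ S | (C.labelGraph j).Adj v x} + (1 / 4 - γ) * Fintype.card V := by linarith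
  convert h5

variable [DecidableEq V]

theorem isNicePartition_of_hulls {C : G.EdgeLabeling (Fin 2)} {η α : ℝ}
    (hη : η ^ (1 / 2 : ℝ) ≤ 1 / 4) {F : Fin 2 → Finset V}
    (hF : ∀ k, IsRobustHull (C.labelGraph k) η α (F k)) (hcov : ∀ v, ∃ k, v ∈ F k)
    (hnice : ∀ k l, k ≠ l → IsNearBipartite (α ^ 4) (inducedOn (C.labelGraph k) (F k)) →
      HasNiceBipartition (C.labelGraph k) (C.labelGraph l) η α (F k) (F l)) :
    IsNicePartition η α C fun k => {inducedOn (C.labelGraph k) (F k)} := by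
  refine ⟨fun k => Set.pairwise_singleton _ _, ?_, ?_, ?_⟩
  · rintro k H rfl
    exact (hF k).1
  · intro v
    obtain ⟨k, hk⟩ := hcov v
    exact ⟨k, _, rfl, hk⟩
  · rintro k H rfl hnb
    obtain ⟨l, hl⟩ : ∃ l, l ≠ k := exists_ne k
    obtain ⟨X, Y, h1, h2, h3, h4, h5⟩ := hnice k l hl.symm hnb
    refine ⟨X, Y, h1, ?_, h3, l, hl, _, rfl, h4, ?_⟩
    · rwa [Set.ncard_coe_finset, Set.ncard_coe_finset]
    · have h6 : (((inducedOn (C.labelGraph l) (F l)).verts ∩ Y).ncard : ℝ) = #(F l ∩ Y) := by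
        rw [← Set.ncard_coe_finset, Finset.coe_inter]
        rfl
      rw [h6]
      refine le_trans ?_ h5
      have : (0 : ℝ) ≤ Fintype.card V := Nat.cast_nonneg _
      nlinarith

end Main

end RobustStructure

open RobustStructure Finset in
theorem mainTheorem2 :
    ∃ (η₀ α₀ : ℝ → ℝ) (n₀ : ℝ → ℕ), (∀ x : ℝ, 0 < x → 0 < η₀ x ∧ 0 < α₀ x) ∧
      ∀ γ η α : ℝ, 0 < γ → γ ≤ 1 / 4 → 0 < η → η ≤ η₀ γ → 0 < α → α ≤ α₀ η →
      ∀ (V : Type u) [Fintype V] (G : SimpleGraph V) [DecidableRel G.Adj]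
        (C : G.EdgeLabeling (Fin 2)),
      n₀ α ≤ Fintype.card V →
      (3 / 4 + γ) * (Fintype.card V : ℝ) ≤ (G.minDegree : ℝ) →
      RobustStructure.HasCyclePartition C ∨
      (∃ (i : Fin 2) (H : (C.labelGraph i).Subgraph),
        RobustStructure.IsRobust η α H ∧
        (1 - η ^ (2 / 3 : ℝ)) * (Fintype.card V : ℝ) ≤ (H.verts.ncard : ℝ) ∧
        ¬ RobustStructure.IsNearBipartite (α ^ 4) H ∧
        ∀ v : V, v ∉ H.verts →
          (RobustStructure.graphDegIn (C.labelGraph i) v H.verts : ℝ) < η * Fintype.card V) ∨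
      (∃ H : ∀ i : Fin 2, (C.labelGraph i).Subgraph,
        (∀ i, RobustStructure.IsRobust η α (H i)) ∧
        RobustStructure.IsNicePartition η α C (fun i => {H i}) ∧
        ((∀ i, (3 / 4 + γ / 2) * (Fintype.card V : ℝ) ≤ ((H i).verts.ncard : ℝ)) ∨
          (∃ i j : Fin 2, i ≠ j ∧
            (1 - η ^ (2 / 3 : ℝ)) * (Fintype.card V : ℝ) ≤ ((H i).verts.ncard : ℝ) ∧
            RobustStructure.IsNearBipartite (α ^ 4) (H i) ∧
            (1 / 2 + η ^ 2) * (Fintype.card V : ℝ) ≤ ((H j).verts.ncard : ℝ))) ∧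
        ∀ (i : Fin 2) (v : V), v ∉ (H i).verts →
          (RobustStructure.graphDegIn (C.labelGraph i) v (H i).verts : ℝ) <
            η * Fintype.card V) := by
  classical
  refine ⟨fun γ => (γ / 1000) ^ 3, fun η => η ^ 2 / 1000, fun α => ⌈1 / α⌉₊,
    fun x hx => ⟨by positivity, by positivity⟩, ?_⟩
  intro γ η α hγ hγ4 hη hη₀ hα hα₀ V _ G _ C hn₀ hδ
  obtain ⟨q, hq, rfl⟩ : ∃ q : ℝ, 0 < q ∧ q ^ 3 = η :=
    ⟨η ^ (1 / 3 : ℝ), Real.rpow_pos_of_pos hη _, by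
      rw [← Real.rpow_natCast, ← Real.rpow_mul hη.le]; norm_num⟩
  have hqγ : q ≤ γ / 1000 := le_of_pow_le_pow_left₀ (by norm_num) (by positivity) hη₀
  have h23 : (q ^ 3) ^ (2 / 3 : ℝ) = q ^ 2 := by
    rw [← Real.rpow_natCast, ← Real.rpow_natCast, ← Real.rpow_mul hq.le]; norm_num
  have h12 : (q ^ 3) ^ (1 / 2 : ℝ) ≤ 1 / 4 := by
    rw [← Real.sqrt_eq_rpow]
    refine Real.sqrt_le_iff.2 ⟨by norm_num, ?_⟩
    have : q ^ 3 ≤ q := pow_le_of_le_one hq.le (by linarith) (by norm_num)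
    linarith
  have h : Constants γ q α (Fintype.card V) := by
    refine ⟨hγ4, hq, by linarith, hα, ?_, ?_⟩
    · have : (q ^ 3) ^ 2 = q ^ 6 := by ring
      simp only [this] at hα₀
      linarith
    · have h1 : 1 / α ≤ Fintype.card V := (Nat.le_ceil _).trans (by exact_mod_cast hn₀)
      rw [div_le_iff₀ hα] at h1
      linarith
  have hmiss : ∀ {i j : Fin 2}, i ≠ j → MissAtMost (C.labelGraph i) (C.labelGraph j)
      ((1 / 4 - γ) * Fintype.card V) := fun hij => missAtMost_labelGraph C hδ hij
  have hdegIn : ∀ (i : Fin 2) (S : Finset V), IsRobustHull (C.labelGraph i) (q ^ 3) α S →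
      ∀ v : V, v ∉ (inducedOn (C.labelGraph i) S).verts →
        (graphDegIn (C.labelGraph i) v (inducedOn (C.labelGraph i) S).verts : ℝ) <
          q ^ 3 * Fintype.card V := by
    intro i S hS v hv
    have h1 := hS.2 v (by simpa using hv)
    rwa [← graphDegIn_eq_deg] at h1
  rw [h23]
  -- Without an almost spanning hull in any colour, the dichotomy started from the other colour
  -- yields a large hull in each; the failure of `hbig` also provides the vertices outside each hull
  -- that niceness needs.
  by_cases hbig : ∃ i S, IsRobustHull (C.labelGraph i) (q ^ 3) α S ∧
      (1 - q ^ 2) * Fintype.card V ≤ #S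
  · obtain ⟨i, S, hS, hSc⟩ := hbig
    by_cases hnb : IsNearBipartite (α ^ 4) (inducedOn (C.labelGraph i) S)
    · obtain ⟨j, hj⟩ : ∃ j, j ≠ i := exists_ne i
      rcases cyclePartition_or_of_large_nearBipartite h (hmiss hj.symm) hS hSc hnb with
        hcyc | ⟨T, hT, hTc, hcov, hTn, hnice⟩
      · exact Or.inl (hasCyclePartition_of hj.symm hcyc)
      refine Or.inr (Or.inr ?_)
      obtain ⟨F, rfl, rfl⟩ : ∃ F : Fin 2 → Finset V, F i = S ∧ F j = T :=
        ⟨fun k => if k = i then S else T, by simp, by simp [hj]⟩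
      have hk : ∀ k : Fin 2, k = i ∨ k = j := fun k => by omega
      have hF : ∀ k, IsRobustHull (C.labelGraph k) (q ^ 3) α (F k) := fun k => by
        rcases hk k with rfl | rfl
        · exact hS
        · exact hT
      refine ⟨fun k => inducedOn (C.labelGraph k) (F k), fun k => (hF k).1,
        isNicePartition_of_hulls h12 hF (fun v => ?_) ?_, Or.inr ⟨i, j, hj.symm, ?_, hnb, ?_⟩,
        fun k => hdegIn k (F k) (hF k)⟩
      · rcases hcov v with hv | hv
        · exact ⟨i, hv⟩
        · exact ⟨j, hv⟩
      · intro k l hkl hkn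
        rcases hk k with rfl | rfl
        · obtain rfl : l = j := by omega
          exact hnice
        · exact absurd hkn hTn
      · rwa [ncard_verts_inducedOn]
      · rwa [ncard_verts_inducedOn]
    · exact Or.inr (Or.inl ⟨i, inducedOn (C.labelGraph i) S, hS.1,
        by rwa [ncard_verts_inducedOn], hnb, hdegIn i S hS⟩)
  · push Not at hbig
    have hex : ∀ k : Fin 2, ∃ S, IsRobustHull (C.labelGraph k) (q ^ 3) α S ∧
        (3 / 4 + γ / 2) * Fintype.card V ≤ #S := by
      intro k
      obtain ⟨l, hl⟩ : ∃ l, l ≠ k := exists_ne k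
      rcases exists_hull_dichotomy h (hmiss hl) with ⟨S, hS, hSc⟩ | hT
      · exact absurd hSc (not_le.2 (hbig l S hS))
      · exact hT
    choose F hF hFc using hex
    refine Or.inr (Or.inr ⟨fun k => inducedOn (C.labelGraph k) (F k), fun k => (hF k).1,
      isNicePartition_of_hulls h12 hF (fun v => ?_) ?_, Or.inl fun k => ?_,
      fun k => hdegIn k (F k) (hF k)⟩)
    · rcases mem_or_mem_of_large_hulls h (hmiss (i := 0) (j := 1) (by decide)) (hF 0) (hF 1)
        (hFc 0) (hFc 1) v with hv | hv
      · exact ⟨0, hv⟩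
      · exact ⟨1, hv⟩
    · intro k l hkl hkn
      exact hasNiceBipartition_of_large_hulls h (hmiss hkl) (hF k) (hF l) (hFc k) (hFc l)
        (hbig l (F l) (hF l)) hkn
    · rw [ncard_verts_inducedOn]
      exact hFc k
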